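/- **Theorem (existence and uniqueness of a minimal-norm solution).** Let $d \ge 2$ and $p \ge 0$ be integers, let $T > 0$, and let $\Omega \subset \mathbb{R}^d$ be a bounded domain with smooth boundary and outward unit normal $\nu$. Let $\mathbb{C} = (C_{ijkl})_{i,j,k,l=1}^d$ be an elasticity tensor with $C_{ijkl} \in C^{\max(2,p+1)}(\overline\Omega)$, with the symmetries $C_{ijkl} = C_{jikl} = C_{ijlk} = C_{klij}$, and such that for some $\Lambda > 0$ and almost every $x \in \Omega$ one has $\sum_{i,j,k,l} C_{ijkl}(x)\,\xi_{ij}\xi_{kl} \ge \Lambda |\xi|^2$ for every symmetric $\xi \in \mathbb{R}^{d\times d}$. Let $\mathbf{f}^*, \mathbf{g}^*$ be $\mathbb{R}^d$-valued boundary data on $\partial\Omega \times (0,T)$, and let $S$ be the set of all $$\mathbf{u} \in L^2\big(0,T; H^{2+p}(\Omega)^d\big) \cap H^2\big(0,T; H^p(\Omega)^d\big)$$ such that $$\mathbf{u}_{tt} = \operatorname{div}(\mathbb{C} : \nabla \mathbf{u}) \ \text{ in } \Omega \times (0,T), \qquad \mathbf{u} = \mathbf{f}^* \ \text{ and } \ \partial_\nu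 \mathbf{u} = \mathbf{g}^* \ \text{ on } \partial\Omega \times (0,T),$$ where $(\mathbb{C}:\nabla\mathbf u)_{ij} = \sum_{k,l} C_{ijkl}\,\partial_l u_k$, $(\operatorname{div}\tau)_i=\sum_j\partial_j\tau_{ij}$, derivatives are weak derivatives, and the boundary conditions hold in the sense of traces for almost every $t \in (0,T)$. If $S$ is nonempty, then there is a unique $\mathbf{u}^* \in S$ such that $$\|\mathbf{u}^*\|_{L^2_{e^{-2t}}(0,T; H^{2+p}(\Omega)^d)} \le \|\mathbf{u}\|_{L^2_{e^{-2t}}(0,T; H^{2+p}(\Omega)^d)} \quad \text{for all } \mathbf{u} \in S,$$ where $\|\mathbf{u}\|^2_{L^2_{e^{-2t}}(0,T; H^{2+p}(\Omega)^d)} = \int_0^T e^{-2t} \|\mathbf{u}(t)\|^2_{H^{2+p}(\Omega)^d}\,dt$ and $\|\mathbf v\|^2_{H^{k}(\Omega)^d}=\sum_{|\alpha|\le k}\|D^\alpha \mathbf v\|^2_{L^2(\Omega)^d}$. -/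

import Mathlib

open MeasureTheory Filter Topology
open scoped ContDiff

noncomputable section

namespace ElasticWave

/-- `ℝᵈ` with its Euclidean norm. -/
abbrev Space (d : ℕ) : Type := EuclideanSpace ℝ (Fin d)

/-- The `i`-th vector of the standard basis of `ℝᵈ`. -/
def basisVec {d : ℕ} (i : Fin d) : Space d := EuclideanSpace.single i 1

/-! ### The domain -/

/-- `ρ` is a smooth defining function of `Ω` near `x`: its gradient does not vanish at `x`, and
near `x` the set `Ω` is `{ρ < 0}`. -/
def IsDefiningFunctionAt {d : ℕ} (Ω : Set (Space d)) (x : Space d) (ρ : Space d → ℝ) : Prop :=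
  ContDiff ℝ ∞ ρ ∧ gradient ρ x ≠ 0 ∧ ∀ᶠ y in 𝓝 x, (y ∈ Ω ↔ ρ y < 0)

/-- A bounded domain (nonempty connected open set) with smooth boundary. -/
structure IsSmoothBoundedDomain {d : ℕ} (Ω : Set (Space d)) : Prop where
  isOpen : IsOpen Ω
  isConnected : IsConnected Ω
  isBounded : Bornology.IsBounded Ω
  smooth_boundary : ∀ x ∈ frontier Ω, ∃ ρ, IsDefiningFunctionAt Ω x ρ

open Classical in
/-- The outward unit normal `ν = ∇ρ / |∇ρ|` at a boundary point, where `ρ` is a defining function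
of `Ω` near that point (the quotient does not depend on the choice of `ρ`). -/
def outwardNormal {d : ℕ} (Ω : Set (Space d)) (x : Space d) : Space d :=
  if h : ∃ ρ, IsDefiningFunctionAt Ω x ρ then
    (‖gradient h.choose x‖)⁻¹ • gradient h.choose x
  else 0

/-- The surface measure `σ` on `∂Ω`. -/
def surfaceMeasure {d : ℕ} (Ω : Set (Space d)) : Measure (Space d) :=
  (Measure.euclideanHausdorffMeasure (d - 1)).restrict (frontier Ω)

/-! ### The Sobolev spaces `Hᵏ(Ω)ᵈ` -/

/-- `φ ∈ C_c^∞(Ω)`. -/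
def IsTestFunction {E : Type*} [NormedAddCommGroup E] [NormedSpace ℝ E]
    (Ω : Set E) (φ : E → ℝ) : Prop :=
  ContDiff ℝ ∞ φ ∧ HasCompactSupport φ ∧ tsupport φ ⊆ Ω

/-- The multi-indices `α ∈ ℕᵈ` with `|α| ≤ k`. -/
def multiIndices (d k : ℕ) : Finset (Fin d → ℕ) :=
  (Fintype.piFinset fun _ => Finset.range (k + 1)).filter fun α => ∑ i, α i ≤ k

theorem mem_multiIndices {d k : ℕ} {α : Fin d → ℕ} : α ∈ multiIndices d k ↔ ∑ i, α i ≤ k := by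
  simp only [multiIndices, Finset.mem_filter, Fintype.mem_piFinset, Finset.mem_range,
    and_iff_right_iff_imp]
  intro h i
  have := Finset.single_le_sum (f := α) (fun j _ => Nat.zero_le _) (Finset.mem_univ i)
  omega

/-- `L²(Ω)ᵈ`. -/
abbrev L2 {d : ℕ} (Ω : Set (Space d)) : Type := Lp (Space d) 2 (volume.restrict Ω)

/-- `v = ∂ᵢ u` weakly in `Ω`. -/
def HasWeakPartial {d : ℕ} (Ω : Set (Space d)) (i : Fin d) (u v : L2 Ω) : Prop :=
  ∀ φ : Space d → ℝ, IsTestFunction Ω φ →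
    ∫ x in Ω, fderiv ℝ φ x (basisVec i) • u x = -∫ x in Ω, φ x • v x

/-- Families `(U_α)`, `|α| ≤ k`, of elements of `L²(Ω)ᵈ`, with the Hilbert norm
`(∑_α ‖U_α‖²)^{1/2}`. -/
abbrev JetSpace {d : ℕ} (Ω : Set (Space d)) (k : ℕ) : Type :=
  PiLp 2 fun _ : multiIndices d k => L2 Ω

theorem test_memLp {d : ℕ} {Ω : Set (Space d)} {ψ : Space d → ℝ} (hc : Continuous ψ)
    (hs : HasCompactSupport ψ) (j : Fin d) :
    MemLp (fun x => ψ x • basisVec j) 2 (volume.restrict Ω) := by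
  apply Continuous.memLp_of_hasCompactSupport
  · fun_prop
  · exact hs.smul_right

theorem integrable_test_smul {d : ℕ} {Ω : Set (Space d)} {ψ : Space d → ℝ} (hc : Continuous ψ)
    (hs : HasCompactSupport ψ) (u : L2 Ω) :
    Integrable (fun x => ψ x • u x) (volume.restrict Ω) :=
  memLp_one_iff_integrable.mp
    ((Lp.memLp u).smul (hc.memLp_of_hasCompactSupport (p := 2) hs))

theorem continuous_integral_test {d : ℕ} {Ω : Set (Space d)} {ψ : Space d → ℝ}
    (hc : Continuous ψ) (hs : HasCompactSupport ψ) :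
    Continuous fun u : L2 Ω => ∫ x in Ω, ψ x • u x := by
  rw [← (EuclideanSpace.equiv (Fin d) ℝ).toHomeomorph.comp_continuous_iff, continuous_pi_iff]
  intro j
  have key : ∀ u : L2 Ω, (∫ x in Ω, ψ x • u x) j
      = inner ℝ ((test_memLp (Ω := Ω) hc hs j).toLp _) u := by
    intro u
    have h1 : (∫ x in Ω, ψ x • u x) j = ∫ x in Ω, (ψ x • u x) j :=
      ((EuclideanSpace.proj (𝕜 := ℝ) j : Space d →L[ℝ] ℝ).integral_comp_comm
        (integrable_test_smul hc hs u)).symm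
    rw [h1, MeasureTheory.L2.inner_def]
    apply integral_congr_ae
    filter_upwards [(test_memLp (Ω := Ω) hc hs j).coeFn_toLp] with x hx
    rw [hx, real_inner_smul_left]
    simp [basisVec, EuclideanSpace.inner_single_left]
  have : (fun u : L2 Ω => (∫ x in Ω, ψ x • u x) j)
      = fun u => inner ℝ ((test_memLp (Ω := Ω) hc hs j).toLp _) u := funext key
  change Continuous (fun u : L2 Ω => (∫ x in Ω, ψ x • u x) j)
  rw [this]
  fun_prop

theorem isTestFunction_fderiv {d : ℕ} {Ω : Set (Space d)} {φ : Space d → ℝ}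
    (h : IsTestFunction Ω φ) (i : Fin d) :
    Continuous (fun x => fderiv ℝ φ x (basisVec i)) ∧
      HasCompactSupport (fun x => fderiv ℝ φ x (basisVec i)) :=
  ⟨(h.1.continuous_fderiv (by simp)).clm_apply continuous_const,
    h.2.1.fderiv_apply (𝕜 := ℝ) (basisVec i)⟩

/-- The Sobolev space `Hᵏ(Ω)ᵈ` with the inner product `∑_{|α| ≤ k} ⟨D^α u, D^α v⟩_{L²(Ω)ᵈ}`. A
function `u` is stored as the family `(D^α u)` of its weak derivatives, which is determined by
its member `D⁰ u = u`: the families that occur are those with `D^{α + eᵢ} u = ∂ᵢ D^α u`. -/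
def Sobolev {d : ℕ} (Ω : Set (Space d)) (k : ℕ) : Submodule ℝ (JetSpace Ω k) where
  carrier := {U | ∀ (α β : multiIndices d k) (i : Fin d),
    β.1 = α.1 + Pi.single i 1 → HasWeakPartial Ω i (U α) (U β)}
  zero_mem' := by
    intro α β i _ φ _
    have h0 : ∀ ψ : Space d → ℝ, ∫ x in Ω, ψ x • (0 : L2 Ω) x = 0 := by
      intro ψ
      rw [integral_congr_ae (g := fun _ => 0)]
      · simp
      · filter_upwards [Lp.coeFn_zero (Space d) 2 (volume.restrict Ω)] with x hx
        rw [hx, Pi.zero_apply, smul_zero]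
    change ∫ x in Ω, fderiv ℝ φ x (basisVec i) • (0 : L2 Ω) x = -∫ x in Ω, φ x • (0 : L2 Ω) x
    rw [h0, h0, neg_zero]
  add_mem' := by
    intro U V hU hV α β i hαβ φ hφ
    have h0 : ∀ ψ : Space d → ℝ, Continuous ψ → HasCompactSupport ψ → ∀ u v : L2 Ω,
        ∫ x in Ω, ψ x • (u + v) x = (∫ x in Ω, ψ x • u x) + ∫ x in Ω, ψ x • v x := by
      intro ψ hc hs u v
      rw [← integral_add (integrable_test_smul hc hs u) (integrable_test_smul hc hs v)]
      apply integral_congr_ae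
      filter_upwards [Lp.coeFn_add u v] with x hx
      rw [hx, Pi.add_apply, smul_add]
    obtain ⟨hc, hs⟩ := isTestFunction_fderiv hφ i
    rw [PiLp.add_apply, PiLp.add_apply, h0 _ hc hs, h0 _ hφ.1.continuous hφ.2.1,
      hU α β i hαβ φ hφ, hV α β i hαβ φ hφ, neg_add]
  smul_mem' := by
    intro c U hU α β i hαβ φ hφ
    have h0 : ∀ (ψ : Space d → ℝ) (u : L2 Ω),
        ∫ x in Ω, ψ x • (c • u) x = c • ∫ x in Ω, ψ x • u x := by
      intro ψ u
      rw [← integral_smul]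
      apply integral_congr_ae
      filter_upwards [Lp.coeFn_smul c u] with x hx
      simp only [hx, Pi.smul_apply]
      exact smul_comm _ _ _
    rw [PiLp.smul_apply, PiLp.smul_apply, h0, h0, hU α β i hαβ φ hφ, smul_neg]

theorem isClosed_sobolev {d : ℕ} (Ω : Set (Space d)) (k : ℕ) :
    IsClosed (Sobolev Ω k : Set (JetSpace Ω k)) := by
  have : (Sobolev Ω k : Set (JetSpace Ω k)) = ⋂ (α : multiIndices d k) (β : multiIndices d k)
      (i : Fin d) (_ : β.1 = α.1 + Pi.single i 1) (φ : Space d → ℝ) (_ : IsTestFunction Ω φ),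
      {U | ∫ x in Ω, fderiv ℝ φ x (basisVec i) • U α x = -∫ x in Ω, φ x • U β x} := by
    ext U
    simp only [Set.mem_iInter]
    rfl
  rw [this]
  refine isClosed_iInter fun α => isClosed_iInter fun β => isClosed_iInter fun i =>
    isClosed_iInter fun _ => isClosed_iInter fun φ => isClosed_iInter fun hφ => ?_
  obtain ⟨hc, hs⟩ := isTestFunction_fderiv hφ i
  exact isClosed_eq ((continuous_integral_test hc hs).comp (PiLp.continuous_apply 2 _ α))
    ((continuous_integral_test hφ.1.continuous hφ.2.1).comp (PiLp.continuous_apply 2 _ β)).neg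

instance {d : ℕ} (Ω : Set (Space d)) (k : ℕ) : CompleteSpace (Sobolev Ω k) :=
  (isClosed_sobolev Ω k).completeSpace_coe

/-- The weak derivative `D^α u ∈ L²(Ω)ᵈ` of `u ∈ Hᵏ(Ω)ᵈ` (used for `|α| ≤ k` only). -/
def Sobolev.D {d : ℕ} {Ω : Set (Space d)} {k : ℕ} (u : Sobolev Ω k) (α : Fin d → ℕ) : L2 Ω :=
  if h : α ∈ multiIndices d k then u.1 ⟨α, h⟩ else 0

/-- The inclusion `H^{2+p}(Ω)ᵈ → H^p(Ω)ᵈ`. -/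
def Sobolev.incl {d : ℕ} {Ω : Set (Space d)} {p : ℕ} (u : Sobolev Ω (2 + p)) : Sobolev Ω p :=
  ⟨WithLp.toLp 2 fun α => u.1 ⟨α.1, mem_multiIndices.2
      ((mem_multiIndices.1 α.2).trans (Nat.le_add_left p 2))⟩,
    fun _ _ i h => u.2 _ _ i h⟩

/-! ### The boundary conditions -/

/-- `Fₙ → F` in `L²(μ)`. -/
def TendstoL2 {d : ℕ} (μ : Measure (Space d)) (F : ℕ → Space d → Space d)
    (f : Space d → Space d) : Prop :=
  (∀ n, MemLp (F n) 2 μ) ∧ MemLp f 2 μ ∧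
    Tendsto (fun n => eLpNorm (fun x => F n x - f x) 2 μ) atTop (𝓝 0)

/-- The classical partial derivative `∂ᵢ φ`. -/
def pderiv {d : ℕ} (i : Fin d) (φ : Space d → Space d) (x : Space d) : Space d :=
  fderiv ℝ φ x (basisVec i)

/-- Convergence in `H¹(Ω)ᵈ` of functions that are smooth up to the boundary. -/
def TendstoH1 {d : ℕ} {Ω : Set (Space d)} {k : ℕ} (φ : ℕ → Space d → Space d)
    (u : Sobolev Ω k) : Prop :=
  (∀ n, ContDiff ℝ ∞ (φ n)) ∧
  TendstoL2 (volume.restrict Ω) φ (Sobolev.D u 0) ∧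
  ∀ i, TendstoL2 (volume.restrict Ω) (fun n => pderiv i (φ n)) (Sobolev.D u (Pi.single i 1))

/-- Convergence in `H²(Ω)ᵈ` of functions that are smooth up to the boundary. -/
def TendstoH2 {d : ℕ} {Ω : Set (Space d)} {k : ℕ} (φ : ℕ → Space d → Space d)
    (u : Sobolev Ω k) : Prop :=
  TendstoH1 φ u ∧
  ∀ i j, TendstoL2 (volume.restrict Ω) (fun n => pderiv j (pderiv i (φ n)))
    (Sobolev.D u (Pi.single i 1 + Pi.single j 1))

/-- `u = f` on `∂Ω` in the sense of traces. The trace operator is the extension by continuity of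
`φ ↦ φ|_∂Ω` from functions smooth up to the boundary to `H¹(Ω)ᵈ → L²(∂Ω)ᵈ`. -/
def HasTrace {d : ℕ} {Ω : Set (Space d)} {k : ℕ} (u : Sobolev Ω k)
    (f : Space d → Space d) : Prop :=
  ∃ φ : ℕ → Space d → Space d, TendstoH1 φ u ∧ TendstoL2 (surfaceMeasure Ω) φ f

/-- `∂_ν u = g` on `∂Ω` in the sense of traces. The normal derivative is the extension by
continuity of `φ ↦ ∂_ν φ|_∂Ω` from functions smooth up to the boundary to
`H²(Ω)ᵈ → L²(∂Ω)ᵈ`. -/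
def HasNormalTrace {d : ℕ} {Ω : Set (Space d)} {k : ℕ} (u : Sobolev Ω k)
    (g : Space d → Space d) : Prop :=
  ∃ φ : ℕ → Space d → Space d, TendstoH2 φ u ∧
    TendstoL2 (surfaceMeasure Ω) (fun n x => fderiv ℝ (φ n) x (outwardNormal Ω x)) g

/-! ### The elastic wave equation -/

/-- The assumptions on the elasticity tensor `C = (C_ijkl)`: all entries are in `C^m(Ω̄)`, the
classical symmetries hold, and `C` is uniformly elliptic on symmetric matrices. -/
structure IsElasticityTensor {d : ℕ} (Ω : Set (Space d)) (m : ℕ)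
    (C : Space d → Fin d → Fin d → Fin d → Fin d → ℝ) : Prop where
  contDiffOn : ∀ i j k l, ContDiffOn ℝ m (fun x => C x i j k l) (closure Ω)
  symm_left : ∀ x ∈ closure Ω, ∀ i j k l, C x i j k l = C x j i k l
  symm_right : ∀ x ∈ closure Ω, ∀ i j k l, C x i j k l = C x i j l k
  symm_pair : ∀ x ∈ closure Ω, ∀ i j k l, C x i j k l = C x k l i j
  coercive : ∃ Λ : ℝ, 0 < Λ ∧ ∀ᵐ x ∂volume.restrict Ω, ∀ ξ : Matrix (Fin d) (Fin d) ℝ,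
    ξ.IsSymm → Λ * ∑ i, ∑ j, ξ i j ^ 2 ≤
      ∑ i, ∑ j, ∑ k, ∑ l, C x i j k l * ξ i j * ξ k l

/-- The stress `(C : ∇u)_ij = ∑_{k,l} C_ijkl ∂_l u_k`. -/
def stress {d : ℕ} {Ω : Set (Space d)} {m : ℕ}
    (C : Space d → Fin d → Fin d → Fin d → Fin d → ℝ) (u : Sobolev Ω m)
    (x : Space d) : Matrix (Fin d) (Fin d) ℝ :=
  fun i j => ∑ k, ∑ l, C x i j k l * Sobolev.D u (Pi.single l 1) x k

/-- `w = div τ` weakly in `Ω`, i.e. `w_i = ∑_j ∂_j τ_ij`. -/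
def HasWeakDiv {d : ℕ} (Ω : Set (Space d)) (τ : Space d → Matrix (Fin d) (Fin d) ℝ)
    (w : L2 Ω) : Prop :=
  ∀ φ : Space d → ℝ, IsTestFunction Ω φ → ∀ i,
    ∫ x in Ω, ∑ j, τ x i j * fderiv ℝ φ x (basisVec j) = -∫ x in Ω, w x i * φ x

/-- Lebesgue measure on the time interval `(0, T)`. -/
abbrev timeMeasure (T : ℝ) : Measure ℝ := volume.restrict (Set.Ioo 0 T)

/-- `v = ∂_t u` weakly in `(0, T)`, for functions with values in a Banach space. -/
def HasWeakTimeDeriv {X : Type*} [NormedAddCommGroup X] [NormedSpace ℝ X] (T : ℝ)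
    (u v : ℝ → X) : Prop :=
  ∀ φ : ℝ → ℝ, IsTestFunction (Set.Ioo 0 T) φ →
    ∫ t in Set.Ioo 0 T, deriv φ t • u t = -∫ t in Set.Ioo 0 T, φ t • v t

/-- `L²(0, T; H^k(Ω)ᵈ)`. -/
abbrev L2Sobolev {d : ℕ} (T : ℝ) (Ω : Set (Space d)) (k : ℕ) : Type :=
  Lp (Sobolev Ω k) 2 (timeMeasure T)

/-- The norm of `L²_{e^{-2t}}(0, T; H^k(Ω)ᵈ)`. -/
def weightedNorm {d : ℕ} {T : ℝ} {Ω : Set (Space d)} {k : ℕ} (u : L2Sobolev T Ω k) : ℝ :=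
  Real.sqrt (∫ t in Set.Ioo 0 T, Real.exp (-2 * t) * ‖u t‖ ^ 2)

/-- The set `S` of all `u ∈ L²(0, T; H^{2+p}(Ω)ᵈ) ∩ H²(0, T; H^p(Ω)ᵈ)` with
`u_tt = div (C : ∇u)` in `Ω × (0, T)`, and `u = f`, `∂_ν u = g` on `∂Ω × (0, T)`. -/
def admissibleSolutions {d : ℕ} (T : ℝ) (Ω : Set (Space d)) (p : ℕ)
    (C : Space d → Fin d → Fin d → Fin d → Fin d → ℝ) (f g : ℝ → Space d → Space d) :
    Set (L2Sobolev T Ω (2 + p)) :=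
  {u | ∃ v w : L2Sobolev T Ω p,
      HasWeakTimeDeriv T (fun t => Sobolev.incl (u t)) v ∧
      HasWeakTimeDeriv T v w ∧
      (∀ᵐ t ∂timeMeasure T, HasWeakDiv Ω (stress C (u t)) (Sobolev.D (w t) 0)) ∧
      (∀ᵐ t ∂timeMeasure T, HasTrace (u t) (f t)) ∧
      (∀ᵐ t ∂timeMeasure T, HasNormalTrace (u t) (g t))}

end ElasticWave

end

/-! The weighted norm of `u` is the ordinary norm of `e^{-t} u` in the Hilbert space `L²(0, T;
H^{2+p})`, and multiplication by `e^{-t}` is a linear homeomorphism of this space, since `e^{-t}`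
and `e^t` are bounded on `(0, T)`. So the theorem is the projection theorem for nonempty closed
convex sets (`existsUnique_norm_le`), once the solution set is closed and convex in `L²(0, T;
H^{2+p})`. Convexity is linearity. Closedness is the point: convergence in this space controls no
time derivative.

Wave equation: if `u'' = w` in the distributional sense and `u`, `w` are in `L²`, then `u'` is in
`L²` as well (`exists_weakTimeDeriv`). The existence of the two time derivatives together with the
equation then amounts to `∫ φ'' u = ∫ φ A u` for all test functions `φ`, where `A u = div (C : ∇u)`.
These conditions are linear and continuous in `u` because `A` is bounded from `H^{2+p}` to `H^p`
(`exists_elasticityOperator`): the Leibniz rule puts the stress in `H^{p+1}`, and the closed graph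
theorem gives boundedness without estimates.

Boundary conditions: traces are defined by approximating sequences, so having trace `f` means that
the derivatives of `u` together with `f` lie in the closure of the data of smooth functions
(`isClosed_convex_setOf_tendstoL2`). This is a closed convex condition at each time, and it survives
`L²` limits because a subsequence converges almost everywhere in time. -/

noncomputable section

namespace ElasticWave

/-! ### Multiplication by bounded functions and pairing with square-integrable functions -/

section LpOperators

variable {α E : Type*} [MeasurableSpace α] {μ : Measure α} [NormedAddCommGroup E] [NormedSpace ℝ E]

/-- Multiplication by an essentially bounded function on `L²`. -/
def bddMul (c : α → ℝ) (hc : MemLp c ⊤ μ) : Lp E 2 μ →L[ℝ] Lp E 2 μ :=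
  (ContinuousLinearMap.lsmul ℝ ℝ).holderL μ ⊤ 2 2 (hc.toLp c)

theorem coeFn_bddMul (c : α → ℝ) (hc : MemLp c ⊤ μ) (u : Lp E 2 μ) :
    bddMul c hc u =ᵐ[μ] fun x => c x • u x := by
  filter_upwards [(ContinuousLinearMap.lsmul ℝ ℝ : ℝ →L[ℝ] E →L[ℝ] E).coeFn_holder (r := 2)
    (hc.toLp c) u, hc.coeFn_toLp] with x h1 h2
  rw [h2] at h1
  exact h1

/-- The pairing `u ↦ ∫ ψ u` with a square-integrable function `ψ`. -/
def pairing [CompleteSpace E] (ψ : α → ℝ) (hψ : MemLp ψ 2 μ) : Lp E 2 μ →L[ℝ] E :=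
  (ContinuousLinearMap.lsmul ℝ ℝ : ℝ →L[ℝ] E →L[ℝ] E).lpPairing μ 2 2 (hψ.toLp ψ)

theorem pairing_apply [CompleteSpace E] (ψ : α → ℝ) (hψ : MemLp ψ 2 μ) (u : Lp E 2 μ) :
    pairing ψ hψ u = ∫ x, ψ x • u x ∂μ := by
  rw [pairing, ContinuousLinearMap.lpPairing_eq_integral]
  apply integral_congr_ae
  filter_upwards [hψ.coeFn_toLp] with x hx
  rw [hx]
  rfl

theorem integrable_smul_of_memLp {ψ : α → ℝ} (hψ : MemLp ψ 2 μ) (u : Lp E 2 μ) :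
    Integrable (fun x => ψ x • u x) μ :=
  memLp_one_iff_integrable.mp ((Lp.memLp u).smul hψ)

/-- An `L²` function with values almost everywhere in prescribed closed sets: these functions
form a closed subset of `L²`. -/
theorem isClosed_setOf_ae_mem {α E : Type*} [MeasurableSpace α] {μ : Measure α}
    [NormedAddCommGroup E] {Z : α → Set E} (hZ : ∀ t, IsClosed (Z t)) :
    IsClosed {u : Lp E 2 μ | ∀ᵐ t ∂μ, u t ∈ Z t} := by
  refine IsSeqClosed.isClosed fun u v hu huv => ?_
  -- An almost everywhere convergent subsequence reduces the claim to closedness of each `Z t`; no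
  -- measurability of `Z` in `t` is needed.
  obtain ⟨ns, -, hns⟩ := (tendstoInMeasure_of_tendsto_Lp huv).exists_seq_tendsto_ae
  have hu' : ∀ᵐ t ∂μ, ∀ n, u n t ∈ Z t := ae_all_iff.2 hu
  filter_upwards [hns, hu'] with t h1 h2
  exact (hZ t).mem_of_tendsto h1 (Eventually.of_forall fun n => h2 (ns n))

theorem convex_setOf_ae_mem {Z : α → Set E} (hZ : ∀ t, Convex ℝ (Z t)) :
    Convex ℝ {u : Lp E 2 μ | ∀ᵐ t ∂μ, u t ∈ Z t} := by
  intro u hu v hv a b ha hb hab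
  filter_upwards [hu, hv, Lp.coeFn_add (a • u) (b • v), Lp.coeFn_smul a u, Lp.coeFn_smul b v]
    with t h1 h2 h3 h4 h5
  rw [h3, Pi.add_apply, h4, h5]
  exact hZ t h1 h2 ha hb hab

end LpOperators

/-! ### Elements of minimal norm, and the weight `e^{-2t}` -/

/-- A nonempty closed convex subset of a Hilbert space has a unique element of minimal norm. -/
theorem existsUnique_norm_le {H : Type*} [NormedAddCommGroup H] [InnerProductSpace ℝ H]
    [CompleteSpace H] {K : Set H} (hne : K.Nonempty) (hcl : IsClosed K) (hK : Convex ℝ K) :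
    ∃! u, u ∈ K ∧ ∀ v ∈ K, ‖u‖ ≤ ‖v‖ := by
  -- Minimality is equivalent to the variational inequality for the projection of `0` onto `K`.
  have key : ∀ u ∈ K, (∀ v ∈ K, ‖u‖ ≤ ‖v‖) ↔ ∀ v ∈ K, inner ℝ (0 - u) (v - u) ≤ 0 := by
    intro u hu
    rw [← norm_eq_iInf_iff_real_inner_le_zero hK hu, zero_sub, norm_neg]
    simp only [zero_sub, norm_neg]
    have : Nonempty K := ⟨⟨u, hu⟩⟩
    have hb : BddBelow (Set.range fun w : K => ‖(w : H)‖) :=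
      ⟨0, by rintro _ ⟨w, rfl⟩; exact norm_nonneg _⟩
    constructor
    · intro h
      exact le_antisymm (le_ciInf fun w => h w w.2) (ciInf_le hb ⟨u, hu⟩)
    · intro h v hv
      rw [h]
      exact ciInf_le hb ⟨v, hv⟩
  obtain ⟨u, hu, hmin⟩ := exists_norm_eq_iInf_of_complete_convex hne hcl.isComplete hK 0
  have hu' := (norm_eq_iInf_iff_real_inner_le_zero hK hu).1 hmin
  refine ⟨u, ⟨hu, (key u hu).2 hu'⟩, ?_⟩
  rintro w ⟨hw, hwmin⟩
  have h1 := hu' w hw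
  have h2 := (key w hw).1 hwmin u hu
  -- Adding the variational inequalities of the two minimizers, each tested with the other.
  have h3 : inner ℝ (w - u) (w - u) ≤ 0 := by
    have : inner ℝ (w - u) (w - u) = inner ℝ (0 - u) (w - u) + inner ℝ (0 - w) (u - w) := by
      rw [← neg_sub w u, inner_neg_right, ← sub_eq_add_neg, ← inner_sub_left]
      congr 1
      abel
    linarith
  rw [real_inner_self_eq_norm_sq] at h3
  exact sub_eq_zero.1 (norm_eq_zero.1 (pow_eq_zero_iff two_ne_zero |>.1 (h3.antisymm (sq_nonneg _))))

/-- The image of `S` under the homeomorphism `M` is again closed and convex, so its element of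
minimal norm can be pulled back. -/
theorem existsUnique_norm_map_le {H : Type*} [NormedAddCommGroup H] [InnerProductSpace ℝ H]
    [CompleteSpace H] (M : H ≃L[ℝ] H) {S : Set H} (hne : S.Nonempty) (hcl : IsClosed S)
    (hS : Convex ℝ S) : ∃! u, u ∈ S ∧ ∀ v ∈ S, ‖M u‖ ≤ ‖M v‖ := by
  obtain ⟨w, ⟨⟨u, hu, rfl⟩, hw⟩, huniq⟩ := existsUnique_norm_le (K := M '' S) (hne.image _)
    (M.toHomeomorph.isClosedMap _ hcl) (hS.is_linear_image ⟨map_add M, map_smul M⟩)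
  refine ⟨u, ⟨hu, fun v hv => hw _ ⟨v, hv, rfl⟩⟩, ?_⟩
  rintro v ⟨hv, hvmin⟩
  refine M.injective (huniq _ ⟨⟨v, hv, rfl⟩, ?_⟩)
  rintro _ ⟨z, hz, rfl⟩
  exact hvmin z hz

/-- The map `u ↦ e^{-t} u` of `L²(0, T; X)`, a linear homeomorphism. -/
theorem exists_weight_equiv {X : Type*} [NormedAddCommGroup X] [NormedSpace ℝ X] (T : ℝ) :
    ∃ M : Lp X 2 (timeMeasure T) ≃L[ℝ] Lp X 2 (timeMeasure T),
      ∀ u, M u =ᵐ[timeMeasure T] fun t => Real.exp (-t) • u t := by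
  have hb : ∀ c : ℝ → ℝ, Continuous c → MemLp c ⊤ (timeMeasure T) := by
    intro c hc
    obtain ⟨K, hK⟩ := (isCompact_Icc (a := 0) (b := T)).exists_bound_of_continuousOn
      hc.continuousOn
    refine memLp_top_of_bound hc.aestronglyMeasurable K ?_
    filter_upwards [ae_restrict_mem measurableSet_Ioo] with t ht
    exact hK t ⟨ht.1.le, ht.2.le⟩
  have h1 := hb (fun t => Real.exp (-t)) (by fun_prop)
  have h2 := hb (fun t => Real.exp t) (by fun_prop)
  refine ⟨ContinuousLinearEquiv.equivOfInverse (bddMul _ h1) (bddMul _ h2) ?_ ?_,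
    fun u => coeFn_bddMul _ h1 u⟩
  · intro u
    apply Lp.ext
    filter_upwards [coeFn_bddMul _ h1 u, coeFn_bddMul _ h2 (bddMul _ h1 u)] with t e1 e2
    rw [e2, e1, smul_smul, ← Real.exp_add]
    simp
  · intro u
    apply Lp.ext
    filter_upwards [coeFn_bddMul _ h2 u, coeFn_bddMul _ h1 (bddMul _ h2 u)] with t e1 e2
    rw [e2, e1, smul_smul, ← Real.exp_add]
    simp

theorem norm_L2_eq_sqrt {α X : Type*} [MeasurableSpace α] {μ : Measure α} [NormedAddCommGroup X]
    [InnerProductSpace ℝ X] (u : Lp X 2 μ) : ‖u‖ = Real.sqrt (∫ t, ‖u t‖ ^ 2 ∂μ) := by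
  rw [norm_eq_sqrt_real_inner, L2.inner_def]
  simp only [real_inner_self_eq_norm_sq]

theorem sqrt_integral_exp_mul_norm_sq {X : Type*} [NormedAddCommGroup X] [InnerProductSpace ℝ X]
    {T : ℝ} (u v : Lp X 2 (timeMeasure T))
    (h : v =ᵐ[timeMeasure T] fun t => Real.exp (-t) • u t) :
    Real.sqrt (∫ t in Set.Ioo 0 T, Real.exp (-2 * t) * ‖u t‖ ^ 2) = ‖v‖ := by
  rw [norm_L2_eq_sqrt]
  congr 1
  apply integral_congr_ae
  filter_upwards [h] with t ht
  rw [ht, norm_smul, mul_pow, Real.norm_eq_abs, Real.abs_exp, ← Real.exp_nat_mul]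
  congr 2
  push_cast
  ring

theorem existsUnique_sqrt_integral_exp_le {X : Type*} [NormedAddCommGroup X]
    [InnerProductSpace ℝ X] [CompleteSpace X] {T : ℝ} {S : Set (Lp X 2 (timeMeasure T))}
    (hne : S.Nonempty) (hcl : IsClosed S) (hS : Convex ℝ S) :
    ∃! u, u ∈ S ∧ ∀ v ∈ S,
      Real.sqrt (∫ t in Set.Ioo 0 T, Real.exp (-2 * t) * ‖u t‖ ^ 2)
        ≤ Real.sqrt (∫ t in Set.Ioo 0 T, Real.exp (-2 * t) * ‖v t‖ ^ 2) := by
  obtain ⟨M, hM⟩ := exists_weight_equiv (X := X) T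
  simp only [fun u => sqrt_integral_exp_mul_norm_sq u _ (hM u)]
  exact existsUnique_norm_map_le M hne hcl hS

/-- A nonempty closed convex set has a unique element of minimal weighted norm. -/
theorem existsUnique_weightedNorm_le {d : ℕ} {T : ℝ} {Ω : Set (Space d)} {k : ℕ}
    {S : Set (L2Sobolev T Ω k)} (hne : S.Nonempty) (hcl : IsClosed S) (hS : Convex ℝ S) :
    ∃! u, u ∈ S ∧ ∀ v ∈ S, weightedNorm u ≤ weightedNorm v :=
  existsUnique_sqrt_integral_exp_le hne hcl hS

/-! ### Weak second derivatives in time -/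

section Time

variable {X : Type*} [NormedAddCommGroup X] [NormedSpace ℝ X] {T : ℝ}

theorem IsTestFunction.deriv_isTestFunction {I : Set ℝ} {φ : ℝ → ℝ} (h : IsTestFunction I φ) :
    IsTestFunction I (deriv φ) :=
  ⟨(contDiff_infty_iff_deriv.1 h.1).2, h.2.1.deriv, (tsupport_deriv_subset (f := φ)).trans h.2.2⟩

theorem IsTestFunction.eq_zero {E : Type*} [NormedAddCommGroup E] [NormedSpace ℝ E] {I : Set E}
    {φ : E → ℝ} (h : IsTestFunction I φ) {t : E} (ht : t ∉ I) : φ t = 0 :=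
  image_eq_zero_of_notMem_tsupport fun h' => ht (h.2.2 h')

theorem IsTestFunction.memLp {E : Type*} [NormedAddCommGroup E] [NormedSpace ℝ E]
    [MeasurableSpace E] [OpensMeasurableSpace E] [FiniteDimensional ℝ E] {I : Set E}
    {φ : E → ℝ} (h : IsTestFunction I φ) (μ : Measure E) [IsFiniteMeasureOnCompacts μ] (q : ENNReal) :
    MemLp φ q μ :=
  h.1.continuous.memLp_of_hasCompactSupport h.2.1

/-- The primitive `t ↦ ∫₀ᵗ w`. -/
def timePrimitive (T : ℝ) (w : ℝ → X) (t : ℝ) : X := ∫ s in Set.Ioo 0 T, (Set.Iio t).indicator w s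

theorem norm_timePrimitive_le {w : ℝ → X} (hw : Integrable w (timeMeasure T)) (t : ℝ) :
    ‖timePrimitive T w t‖ ≤ ∫ s in Set.Ioo 0 T, ‖w s‖ := by
  refine (norm_integral_le_integral_norm _).trans (integral_mono_ae ?_ hw.norm ?_)
  · exact (hw.indicator measurableSet_Iio).norm
  · exact Eventually.of_forall fun s => norm_indicator_le_norm_self _ _

/-- Joint measurability of the kernel `1_{s < t} w(s)`, needed for Fubini. -/
theorem aestronglyMeasurable_indicator_uncurry {X : Type*} [NormedAddCommGroup X] {w : ℝ → X}
    (hw : AEStronglyMeasurable w (timeMeasure T)) :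
    AEStronglyMeasurable (fun z : ℝ × ℝ => (Set.Iio z.1).indicator w z.2)
      ((timeMeasure T).prod (timeMeasure T)) := by
  have : (fun z : ℝ × ℝ => (Set.Iio z.1).indicator w z.2)
      = {z : ℝ × ℝ | z.2 < z.1}.indicator fun z => w z.2 := by
    ext z
    simp [Set.indicator]
  rw [this]
  exact hw.comp_snd.indicator (measurableSet_lt measurable_snd measurable_fst)

theorem memLp_timePrimitive {w : ℝ → X} (hw : Integrable w (timeMeasure T)) :
    MemLp (timePrimitive T w) 2 (timeMeasure T) := by
  refine MemLp.of_bound ?_ _ (Eventually.of_forall (norm_timePrimitive_le hw))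
  exact (aestronglyMeasurable_indicator_uncurry hw.1).integral_prod_right'

variable [CompleteSpace X]

/-- Fubini: for fixed `s`, the factor of `w s` is the integral of `φ'` over `(s, T)`, which is
`-φ(s)` because `φ(T) = 0`. -/
theorem integral_deriv_smul_timePrimitive {w : ℝ → X} (hw : Integrable w (timeMeasure T))
    {φ : ℝ → ℝ} (hφ : IsTestFunction (Set.Ioo 0 T) φ) :
    ∫ t in Set.Ioo 0 T, deriv φ t • timePrimitive T w t = -∫ t in Set.Ioo 0 T, φ t • w t := by
  have hd := hφ.deriv_isTestFunction
  have hint : Integrable (Function.uncurry fun t s => deriv φ t • (Set.Iio t).indicator w s)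
      ((timeMeasure T).prod (timeMeasure T)) := by
    have h1 : Integrable (fun z : ℝ × ℝ => deriv φ z.1 • w z.2)
        ((timeMeasure T).prod (timeMeasure T)) :=
      (memLp_one_iff_integrable.1 (hd.memLp _ 1)).smul_prod hw
    refine h1.mono ?_ (Eventually.of_forall fun z => ?_)
    · exact (hd.1.continuous.comp continuous_fst).aestronglyMeasurable.smul
        (aestronglyMeasurable_indicator_uncurry hw.1)
    · simp only [Function.uncurry, norm_smul]
      gcongr
      exact norm_indicator_le_norm_self _ _
  simp only [timePrimitive, ← integral_smul]
  rw [integral_integral_swap hint, ← integral_neg]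
  refine setIntegral_congr_fun measurableSet_Ioo fun s hs => ?_
  have h1 : ∀ t, deriv φ t • (Set.Iio t).indicator w s
      = (Set.Ioi s).indicator (deriv φ) t • w s := by
    intro t
    by_cases h : s < t <;> simp [h]
  simp only [h1]
  rw [integral_smul_const, integral_indicator measurableSet_Ioi, Measure.restrict_restrict
    measurableSet_Ioi, ← neg_smul]
  congr 1
  have h2 : Set.Ioi s ∩ Set.Ioo 0 T = Set.Ioo s T := by
    ext t
    simp only [Set.mem_inter_iff, Set.mem_Ioi, Set.mem_Ioo]
    exact ⟨fun h => ⟨h.1, h.2.2⟩, fun h => ⟨h.1, hs.1.trans h.1, h.2⟩⟩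
  rw [h2, ← integral_Ioc_eq_integral_Ioo, ← intervalIntegral.integral_of_le hs.2.le,
    intervalIntegral.integral_deriv_eq_sub (fun t _ => (hφ.1.differentiable (by simp)) t)
      (hd.1.continuous.intervalIntegrable _ _), hφ.eq_zero (t := T) (by simp), zero_sub]

theorem exists_isTestFunction_integral_eq_one (hT : 0 < T) :
    ∃ φ : ℝ → ℝ, IsTestFunction (Set.Ioo 0 T) φ ∧ ∫ t in Set.Ioo 0 T, φ t = 1 := by
  let b : ContDiffBump (T / 2 : ℝ) := ⟨T / 8, T / 4, by positivity, by linarith⟩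
  have hs : tsupport (b.normed volume) ⊆ Set.Ioo 0 T := by
    rw [b.tsupport_normed_eq, Real.closedBall_eq_Icc]
    intro t ht
    change T / 2 - T / 4 ≤ t ∧ t ≤ T / 2 + T / 4 at ht
    constructor <;> linarith [ht.1, ht.2]
  refine ⟨b.normed volume, ⟨b.contDiff_normed, b.hasCompactSupport_normed, hs⟩, ?_⟩
  rw [setIntegral_eq_integral_of_forall_compl_eq_zero, b.integral_normed]
  exact fun t ht => image_eq_zero_of_notMem_tsupport fun h => ht (hs h)

/-- A test function with vanishing integral is the derivative of a test function. -/
theorem exists_isTestFunction_deriv_eq {ψ : ℝ → ℝ} (hψ : IsTestFunction (Set.Ioo 0 T) ψ)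
    (h0 : ∫ t in Set.Ioo 0 T, ψ t = 0) :
    ∃ φ, IsTestFunction (Set.Ioo 0 T) φ ∧ deriv φ = ψ := by
  rcases le_or_gt T 0 with hT | hT
  · refine ⟨ψ, hψ, ?_⟩
    have : ψ = fun _ => 0 := by
      ext t
      exact hψ.eq_zero (by simp [hT])
    rw [this]
    simp
  have hc := hψ.1.continuous
  have hder : ∀ t, HasDerivAt (fun t => ∫ s in (0 : ℝ)..t, ψ s) (ψ t) t := fun t =>
    intervalIntegral.integral_hasDerivAt_right (hc.intervalIntegrable _ _)
      hc.aestronglyMeasurable.stronglyMeasurableAtFilter hc.continuousAt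
  have hdd : deriv (fun t => ∫ s in (0 : ℝ)..t, ψ s) = ψ := funext fun t => (hder t).deriv
  -- a compact interval inside `(0, T)` that contains the support of `ψ`
  obtain ⟨a, b, ha, hb, hab⟩ : ∃ a b, 0 < a ∧ b < T ∧ tsupport ψ ⊆ Set.Icc a b := by
    rcases (tsupport ψ).eq_empty_or_nonempty with he | hne
    · exact ⟨T / 2, T / 2, by linarith, by linarith, by simp [he]⟩
    · have hk : IsCompact (tsupport ψ) := hψ.2.1
      refine ⟨sInf (tsupport ψ), sSup (tsupport ψ), (hψ.2.2 (hk.sInf_mem hne)).1,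
        (hψ.2.2 (hk.sSup_mem hne)).2, fun t ht => ⟨csInf_le hk.bddBelow ht,
          le_csSup hk.bddAbove ht⟩⟩
  have hz : ∀ t, t ∉ Set.Icc a b → ψ t = 0 := fun t ht =>
    image_eq_zero_of_notMem_tsupport fun h => ht (hab h)
  -- To the left of `a` the integrand vanishes; to the right of `b` the primitive equals the total
  -- integral, which is zero by `h0`.
  have hzero : ∀ t, t ∉ Set.Icc a b → ∫ s in (0 : ℝ)..t, ψ s = 0 := by
    intro t ht
    rcases lt_or_ge t a with h | h
    · rw [intervalIntegral.integral_zero_ae]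
      refine Eventually.of_forall fun s hs => hz s fun h' => ?_
      rcases Set.mem_uIoc.1 hs with h2 | h2
      · linarith [h2.2, h'.1]
      · linarith [h2.2, h'.1]
    · have hbt : b < t := by
        by_contra h'
        exact ht ⟨h, not_lt.1 h'⟩
      have h3 : ∫ s in (0 : ℝ)..T, ψ s = 0 := by
        rw [intervalIntegral.integral_of_le hT.le, integral_Ioc_eq_integral_Ioo, h0]
      rw [← intervalIntegral.integral_add_adjacent_intervals (b := T)
        (hc.intervalIntegrable _ _) (hc.intervalIntegrable _ _), h3, zero_add,
        intervalIntegral.integral_zero_ae]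
      refine Eventually.of_forall fun s hs => hz s fun h' => ?_
      rcases Set.mem_uIoc.1 hs with h2 | h2
      · linarith [h2.1, h'.2]
      · linarith [h2.1, h'.2]
  have hts : tsupport (fun t => ∫ s in (0 : ℝ)..t, ψ s) ⊆ Set.Icc a b :=
    closure_minimal (fun t ht => by_contra fun h => ht (hzero t h)) isClosed_Icc
  refine ⟨_, ⟨?_, HasCompactSupport.intro isCompact_Icc hzero,
    hts.trans fun t ht => ⟨ha.trans_le ht.1, ht.2.trans_lt hb⟩⟩, hdd⟩
  exact contDiff_infty_iff_deriv.2 ⟨fun t => (hder t).differentiableAt, by rw [hdd]; exact hψ.1⟩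

/-- A function in `L²(0, T; X)` whose second derivative is in `L²(0, T; X)` has its first
derivative in `L²(0, T; X)`. -/
theorem exists_weakTimeDeriv (hT : 0 < T) (u w : Lp X 2 (timeMeasure T))
    (h : ∀ φ : ℝ → ℝ, IsTestFunction (Set.Ioo 0 T) φ →
      ∫ t in Set.Ioo 0 T, deriv (deriv φ) t • u t = ∫ t in Set.Ioo 0 T, φ t • w t) :
    ∃ v : Lp X 2 (timeMeasure T), HasWeakTimeDeriv T u v ∧ HasWeakTimeDeriv T v w := by
  have hw : Integrable w (timeMeasure T) := (Lp.memLp w).integrable (by norm_num)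
  obtain ⟨φ₀, hφ₀, hint⟩ := exists_isTestFunction_integral_eq_one hT
  have hW := memLp_timePrimitive hw
  set W := timePrimitive T (w : ℝ → X) with hWdef
  -- The first derivative must be `W` plus a constant; testing `u' = W + c` against `φ₀`, which has
  -- integral one, forces this value of `c`.
  set c : X := -(∫ t in Set.Ioo 0 T, deriv φ₀ t • u t) - ∫ t in Set.Ioo 0 T, φ₀ t • W t with hc
  have hv : MemLp (fun t => W t + c) 2 (timeMeasure T) := hW.add (memLp_const c)
  have iW : ∀ φ : ℝ → ℝ, IsTestFunction (Set.Ioo 0 T) φ →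
      Integrable (fun t => φ t • W t) (timeMeasure T) := fun φ hφ =>
    memLp_one_iff_integrable.mp (hW.smul (hφ.memLp _ 2))
  have i1 : ∀ φ : ℝ → ℝ, IsTestFunction (Set.Ioo 0 T) φ → Integrable φ (timeMeasure T) :=
    fun φ hφ => memLp_one_iff_integrable.1 (hφ.memLp _ 1)
  have hvint : ∀ φ : ℝ → ℝ, IsTestFunction (Set.Ioo 0 T) φ →
      ∫ t in Set.Ioo 0 T, φ t • (hv.toLp _) t
        = (∫ t in Set.Ioo 0 T, φ t • W t) + (∫ t in Set.Ioo 0 T, φ t) • c := by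
    intro φ hφ
    rw [← integral_smul_const, ← integral_add (iW φ hφ) ((i1 φ hφ).smul_const c)]
    apply integral_congr_ae
    filter_upwards [hv.coeFn_toLp] with t ht
    rw [ht, smul_add]
  refine ⟨hv.toLp _, ?_, ?_⟩
  · intro φ hφ
    rw [hvint φ hφ]
    set m := ∫ t in Set.Ioo 0 T, φ t with hm
    -- Subtracting `m φ₀` makes the integral vanish, so the difference is `ψ'` for a test function
    -- `ψ`. Then `h` at `ψ` and the primitive identity at `ψ` give `∫ χ' u = -∫ χ W` for `χ = φ - m
    -- φ₀`.
    have hχ : IsTestFunction (Set.Ioo 0 T) (fun t => φ t - m * φ₀ t) := by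
      refine ⟨hφ.1.sub (contDiff_const.mul hφ₀.1), hφ.2.1.sub (hφ₀.2.1.mul_left), ?_⟩
      refine (tsupport_sub φ _).trans (Set.union_subset hφ.2.2 ?_)
      exact (tsupport_mul_subset_right (f := fun _ => m) (g := φ₀)).trans hφ₀.2.2
    obtain ⟨ψ, hψ, hψd⟩ := exists_isTestFunction_deriv_eq hχ (by
      rw [integral_sub (i1 φ hφ) ((i1 φ₀ hφ₀).const_mul m), integral_const_mul, hint, mul_one,
        ← hm, sub_self])
    have e1 := h ψ hψ
    have e2 := integral_deriv_smul_timePrimitive hw hψ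
    rw [hψd] at e1 e2
    have hdd : deriv (fun t => φ t - m * φ₀ t) = fun t => deriv φ t - m * deriv φ₀ t := by
      ext t
      have d1 := (hφ.1.differentiable (by simp) t)
      have d2 := (hφ₀.1.differentiable (by simp) t)
      rw [deriv_fun_sub d1 (d2.const_mul m), deriv_const_mul _ d2]
    rw [hdd] at e1
    have j1 := integrable_smul_of_memLp (hφ.deriv_isTestFunction.memLp (timeMeasure T) 2) u
    have j2 := integrable_smul_of_memLp (hφ₀.deriv_isTestFunction.memLp (timeMeasure T) 2) u
    simp only [sub_smul, mul_smul] at e1 e2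
    have j3 : Integrable (fun t => m • deriv φ₀ t • u t) (timeMeasure T) := j2.smul m
    have j4 : Integrable (fun t => m • φ₀ t • W t) (timeMeasure T) := (iW φ₀ hφ₀).smul m
    rw [integral_sub j1 j3, integral_smul] at e1
    rw [integral_sub (iW φ hφ) j4, integral_smul] at e2
    rw [← neg_eq_iff_eq_neg.2 e2, sub_eq_iff_eq_add] at e1
    rw [e1, hc, smul_sub, smul_neg]
    abel
  · intro φ hφ
    rw [hvint _ hφ.deriv_isTestFunction, integral_deriv_smul_timePrimitive hw hφ]
    have : ∫ t in Set.Ioo 0 T, deriv φ t = 0 := by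
      rw [← integral_Ioc_eq_integral_Ioo, ← intervalIntegral.integral_of_le hT.le,
        intervalIntegral.integral_deriv_eq_sub (fun t _ => (hφ.1.differentiable (by simp)) t)
        (hφ.deriv_isTestFunction.1.continuous.intervalIntegrable _ _), hφ.eq_zero (t := T) (by simp),
        hφ.eq_zero (t := 0) (by simp), sub_zero]
    rw [this, zero_smul, add_zero]

end Time

/-! ### Weak partial derivatives -/

section WeakPartial

variable {d : ℕ} {Ω : Set (Space d)}

theorem IsTestFunction.fderiv_basisVec {φ : Space d → ℝ} (h : IsTestFunction Ω φ) (i : Fin d) :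
    IsTestFunction Ω (fun x => fderiv ℝ φ x (basisVec i)) :=
  ⟨(h.1.fderiv_right (m := ∞) (by simp)).clm_apply contDiff_const,
    h.2.1.fderiv_apply (𝕜 := ℝ) (basisVec i),
    (tsupport_fderiv_apply_subset ℝ (basisVec i)).trans h.2.2⟩

theorem fderiv_basisVec_comm {φ : Space d → ℝ} (h : IsTestFunction Ω φ) (i j : Fin d)
    (x : Space d) :
    fderiv ℝ (fun y => fderiv ℝ φ y (basisVec i)) x (basisVec j)
      = fderiv ℝ (fun y => fderiv ℝ φ y (basisVec j)) x (basisVec i) := by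
  have hd : DifferentiableAt ℝ (fderiv ℝ φ) x :=
    (h.1.fderiv_right (m := ∞) (by simp)).differentiable (by simp) x
  have key : ∀ a b : Space d, fderiv ℝ (fun y => fderiv ℝ φ y a) x b
      = fderiv ℝ (fderiv ℝ φ) x b a := by
    intro a b
    rw [fderiv_clm_apply hd (differentiableAt_const a)]
    simp
  rw [key, key]
  exact (h.1.contDiffAt.isSymmSndFDerivAt (by
    rw [minSmoothness_of_isRCLikeNormedField]
    exact WithTop.coe_le_coe.2 (le_top : (2 : ℕ∞) ≤ ⊤))).eq _ _

/-- The fundamental lemma of the calculus of variations; every uniqueness statement for weak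
derivatives below comes from it. -/
theorem L2_ext_of_forall_integral_smul_eq (hΩ : IsOpen Ω) {u v : L2 Ω}
    (h : ∀ φ : Space d → ℝ, IsTestFunction Ω φ →
      ∫ x in Ω, φ x • u x = ∫ x in Ω, φ x • v x) : u = v := by
  have hloc : ∀ w : L2 Ω, LocallyIntegrableOn w Ω (volume.restrict Ω) := fun w =>
    ((Lp.memLp w).locallyIntegrable (by norm_num)).locallyIntegrableOn Ω
  have := hΩ.ae_eq_zero_of_integral_contDiff_smul_eq_zero (μ := volume.restrict Ω)
    ((hloc u).sub (hloc v)) (fun φ h1 h2 h3 => by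
      have hφ : MemLp φ 2 (volume.restrict Ω) := IsTestFunction.memLp ⟨h1, h2, h3⟩ _ _
      simp only [Pi.sub_apply, smul_sub]
      rw [integral_sub (integrable_smul_of_memLp hφ u) (integrable_smul_of_memLp hφ v),
        h φ ⟨h1, h2, h3⟩, sub_self])
  apply Lp.ext
  filter_upwards [this, ae_restrict_mem hΩ.measurableSet] with x hx hxΩ
  exact sub_eq_zero.1 (hx hxΩ)

theorem hasWeakPartial_iff {i : Fin d} {u v : L2 Ω} :
    HasWeakPartial Ω i u v ↔ ∀ (φ : Space d → ℝ) (h : IsTestFunction Ω φ),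
      pairing _ ((h.fderiv_basisVec i).memLp (volume.restrict Ω) 2) u
        = -pairing _ (h.memLp (volume.restrict Ω) 2) v := by
  simp only [pairing_apply]
  rfl

theorem HasWeakPartial.unique (hΩ : IsOpen Ω) {i : Fin d} {u v w : L2 Ω}
    (h : HasWeakPartial Ω i u v) (h' : HasWeakPartial Ω i u w) : v = w :=
  L2_ext_of_forall_integral_smul_eq hΩ fun φ hφ => neg_injective ((h φ hφ).symm.trans (h' φ hφ))

/-- Both second derivatives are moved onto the test function, where partial derivatives commute. -/
theorem HasWeakPartial.comm (hΩ : IsOpen Ω) {i j : Fin d} {u v v' w w' : L2 Ω}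
    (h1 : HasWeakPartial Ω i u v) (h2 : HasWeakPartial Ω j v w)
    (h1' : HasWeakPartial Ω j u v') (h2' : HasWeakPartial Ω i v' w') : w = w' := by
  refine L2_ext_of_forall_integral_smul_eq hΩ fun φ hφ => neg_injective ?_
  rw [← h2 φ hφ, ← h2' φ hφ]
  apply neg_injective
  rw [← h1 _ (hφ.fderiv_basisVec j), ← h1' _ (hφ.fderiv_basisVec i)]
  simp only [fderiv_basisVec_comm hφ i j]

theorem HasWeakPartial.add {i : Fin d} {u v u' v' : L2 Ω} (h : HasWeakPartial Ω i u v)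
    (h' : HasWeakPartial Ω i u' v') : HasWeakPartial Ω i (u + u') (v + v') := by
  rw [hasWeakPartial_iff] at *
  intro φ hφ
  rw [map_add, map_add, h φ hφ, h' φ hφ, neg_add]

theorem HasWeakPartial.smul {i : Fin d} {u v : L2 Ω} (h : HasWeakPartial Ω i u v) (c : ℝ) :
    HasWeakPartial Ω i (c • u) (c • v) := by
  rw [hasWeakPartial_iff] at *
  intro φ hφ
  rw [map_smul, map_smul, h φ hφ, smul_neg]

theorem hasWeakPartial_zero (i : Fin d) : HasWeakPartial Ω i 0 0 := by
  rw [hasWeakPartial_iff]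
  intro φ hφ
  rw [map_zero, map_zero, neg_zero]

theorem integral_smul_compLp {ψ : Space d → ℝ} (hψ : MemLp ψ 2 (volume.restrict Ω))
    (L : Space d →L[ℝ] Space d) (u : L2 Ω) :
    ∫ x in Ω, ψ x • L.compLp u x = L (∫ x in Ω, ψ x • u x) := by
  rw [← L.integral_comp_comm (integrable_smul_of_memLp hψ u)]
  apply integral_congr_ae
  filter_upwards [L.coeFn_compLp u] with x hx
  rw [hx, map_smul]

theorem HasWeakPartial.compLp {i : Fin d} {u v : L2 Ω} (h : HasWeakPartial Ω i u v)
    (L : Space d →L[ℝ] Space d) : HasWeakPartial Ω i (L.compLp u) (L.compLp v) := by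
  intro φ hφ
  rw [integral_smul_compLp ((hφ.fderiv_basisVec i).memLp _ 2), integral_smul_compLp (hφ.memLp _ 2),
    h φ hφ, map_neg]

/-! ### Test functions of class `C¹` -/

open scoped Convolution in
theorem tendsto_integral_convolution_smul [IsFiniteMeasure (volume.restrict Ω)]
    {b : ℕ → ContDiffBump (0 : Space d)} (hb : Tendsto (fun n => (b n).rOut) atTop (𝓝 0))
    {g : Space d → ℝ} (hg : Continuous g) (hs : HasCompactSupport g) (u : L2 Ω) :
    Tendsto (fun n => ∫ x in Ω,
      ((b n).normed volume ⋆[ContinuousLinearMap.lsmul ℝ ℝ, volume] g) x • u x) atTop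
      (𝓝 (∫ x in Ω, g x • u x)) := by
  obtain ⟨K, hK⟩ := hg.bounded_above_of_compact_support hs
  have hbd : ∀ n x,
      -- The constant is `2K` for the oscillation of `g` plus `K` for its size; only some integrable
      -- majorant is needed.
      ‖((b n).normed volume ⋆[ContinuousLinearMap.lsmul ℝ ℝ, volume] g) x‖ ≤ 3 * K := by
    intro n x
    have h1 := (b n).dist_normed_convolution_le (μ := volume) (x₀ := x) (ε := 2 * K)
      hg.aestronglyMeasurable (fun y _ => by
        rw [dist_eq_norm]
        linarith [norm_sub_le (g y) (g x), hK x, hK y])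
    rw [dist_eq_norm] at h1
    have h2 := norm_le_norm_sub_add
      (((b n).normed volume ⋆[ContinuousLinearMap.lsmul ℝ ℝ, volume] g) x) (g x)
    linarith [hK x]
  have hu : Integrable u (volume.restrict Ω) := (Lp.memLp u).integrable (by norm_num)
  have hcont : ∀ n, Continuous
      ((b n).normed volume ⋆[ContinuousLinearMap.lsmul ℝ ℝ, volume] g : Space d → ℝ) := fun n =>
    ((b n).hasCompactSupport_normed.contDiff_convolution_left (n := 0) _
      (b n).contDiff_normed hg.locallyIntegrable).continuous
  refine tendsto_integral_of_dominated_convergence (fun x => 3 * K * ‖u x‖)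
    (fun n => (hcont n).aestronglyMeasurable.smul hu.1) (hu.norm.const_mul _) (fun n => Eventually.of_forall fun x => ?_)
    (Eventually.of_forall fun x => ?_)
  · rw [norm_smul]
    exact mul_le_mul_of_nonneg_right (hbd n x) (norm_nonneg _)
  · exact (ContDiffBump.convolution_tendsto_right_of_continuous hb hg x).smul_const _

open scoped Convolution in
-- Mollification extends the defining identity from smooth to `C¹` test functions. The Leibniz rule
-- needs this, because a test function times a coefficient is only as smooth as the coefficient.
theorem HasWeakPartial.integral_fderiv_smul [IsFiniteMeasure (volume.restrict Ω)]
    (hΩ : IsOpen Ω) {i : Fin d} {u v : L2 Ω} (h : HasWeakPartial Ω i u v)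
    {ψ : Space d → ℝ} (hψ : ContDiff ℝ 1 ψ) (hs : HasCompactSupport ψ) (hsub : tsupport ψ ⊆ Ω) :
    ∫ x in Ω, fderiv ℝ ψ x (basisVec i) • u x = -∫ x in Ω, ψ x • v x := by
  obtain ⟨δ, hδ, hδΩ⟩ := IsCompact.exists_cthickening_subset_open hs hΩ hsub
  let b : ℕ → ContDiffBump (0 : Space d) := fun n =>
    ⟨δ / (n + 1) / 2, δ / (n + 1), by positivity, half_lt_self (by positivity)⟩
  have hb : Tendsto (fun n => (b n).rOut) atTop (𝓝 0) :=
    tendsto_const_div_atTop_nhds_zero_nat δ |>.comp (tendsto_add_atTop_nat 1) |>.congr fun n => by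
      simp [b]
  have hbδ : ∀ n, (b n).rOut ≤ δ := fun n =>
    div_le_self hδ.le (by linarith [(Nat.cast_nonneg n : (0 : ℝ) ≤ n)])
  set ψn : ℕ → Space d → ℝ := fun n =>
    ((b n).normed volume ⋆[ContinuousLinearMap.lsmul ℝ ℝ, volume] ψ) with hψn
  have hzero : ∀ n x, x ∉ Metric.cthickening δ (tsupport ψ) → ψn n x = 0 := by
    intro n x hx
    have hz : ∀ y ∈ Metric.ball x (b n).rOut, ψ y = 0 := by
      intro y hy
      refine image_eq_zero_of_notMem_tsupport fun hy' => hx ?_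
      exact Metric.mem_cthickening_of_dist_le x y δ _ hy'
        ((dist_comm x y).trans_le ((Metric.mem_ball.1 hy).le.trans (hbδ n)))
    have hx0 := hz x (Metric.mem_ball_self (b n).rOut_pos)
    -- With `ε = 0`: `ψ` vanishes on the whole ball of radius `rOut` about `x`, so its average there
    -- is exactly zero.
    have h1 := (b n).dist_normed_convolution_le (μ := volume) (x₀ := x) (ε := 0)
      hψ.continuous.aestronglyMeasurable (fun y hy => by rw [hz y hy, hx0, dist_self])
    rw [hx0] at h1
    exact dist_le_zero.1 h1
  have htest : ∀ n, IsTestFunction Ω (ψn n) := by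
    intro n
    have hts : tsupport (ψn n) ⊆ Metric.cthickening δ (tsupport ψ) :=
      closure_minimal (fun x hx => by_contra fun h => hx (hzero n x h)) Metric.isClosed_cthickening
    exact ⟨(b n).hasCompactSupport_normed.contDiff_convolution_left _
      (b n).contDiff_normed hψ.continuous.locallyIntegrable,
      HasCompactSupport.intro (hs : IsCompact _).cthickening (hzero n), hts.trans hδΩ⟩
  have hder : ∀ n x, fderiv ℝ (ψn n) x (basisVec i)
      = ((b n).normed volume ⋆[ContinuousLinearMap.lsmul ℝ ℝ, volume]
        fun y => fderiv ℝ ψ y (basisVec i)) x := by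
    intro n x
    have hloc : LocallyIntegrable ((b n).normed volume) (volume : Measure (Space d)) :=
      (b n).continuous_normed.locallyIntegrable
    rw [hψn, (hs.hasFDerivAt_convolution_right _ hloc hψ x).fderiv]
    exact convolution_precompR_apply _ hloc (hs.fderiv (𝕜 := ℝ))
      (hψ.continuous_fderiv (by simp)) x (basisVec i)
  have t1 := tendsto_integral_convolution_smul hb
    ((hψ.continuous_fderiv (by simp)).clm_apply continuous_const)
    (hs.fderiv_apply (𝕜 := ℝ) (basisVec i)) u
  have t2 := (tendsto_integral_convolution_smul hb hψ.continuous hs v).neg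
  refine tendsto_nhds_unique t1 (t2.congr fun n => ?_)
  rw [← h (ψn n) (htest n)]
  simp only [hder]

/-! ### Functions with bounded derivatives -/

/-- `c` is of class `C^m` in `Ω`, with bounded derivatives of order at most `m`. -/
def HasBddDerivs (Ω : Set (Space d)) (m : ℕ) (c : Space d → ℝ) : Prop :=
  ContDiffOn ℝ m c Ω ∧ ∀ n ≤ m, ∃ K, ∀ x ∈ Ω, ‖iteratedFDeriv ℝ n c x‖ ≤ K

theorem HasBddDerivs.mono {m n : ℕ} {c : Space d → ℝ} (h : HasBddDerivs Ω m c) (hn : n ≤ m) :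
    HasBddDerivs Ω n c :=
  ⟨h.1.of_le (by exact_mod_cast hn), fun k hk => h.2 k (hk.trans hn)⟩

theorem HasBddDerivs.memLp_top (hΩ : IsOpen Ω) {m : ℕ} {c : Space d → ℝ}
    (h : HasBddDerivs Ω m c) : MemLp c ⊤ (volume.restrict Ω) := by
  obtain ⟨K, hK⟩ := h.2 0 (Nat.zero_le m)
  refine memLp_top_of_bound (h.1.continuousOn.aestronglyMeasurable hΩ.measurableSet) K ?_
  filter_upwards [ae_restrict_mem hΩ.measurableSet] with x hx
  simpa using hK x hx

theorem HasBddDerivs.fderiv_apply (hΩ : IsOpen Ω) {m : ℕ} {c : Space d → ℝ}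
    (h : HasBddDerivs Ω (m + 1) c) (e : Space d) :
    HasBddDerivs Ω m (fun x => fderiv ℝ c x e) := by
  have h1 : ContDiffOn ℝ m (fderiv ℝ c) Ω := h.1.fderiv_of_isOpen hΩ (by simp)
  refine ⟨h1.clm_apply contDiffOn_const, fun n hn => ?_⟩
  obtain ⟨K, hK⟩ := h.2 (n + 1) (by omega)
  refine ⟨‖ContinuousLinearMap.apply ℝ ℝ e‖ * K, fun x hx => ?_⟩
  refine ((ContinuousLinearMap.apply ℝ ℝ e).norm_iteratedFDeriv_comp_left
    (h1.contDiffAt (hΩ.mem_nhds hx)) (by exact_mod_cast hn)).trans ?_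
  rw [norm_iteratedFDeriv_fderiv]
  exact mul_le_mul_of_nonneg_left (hK x hx) (norm_nonneg _)

/-- Near each point of the compact closure the function has a Taylor series that is continuous up to
the boundary, hence locally bounded; finitely many such neighbourhoods suffice. The bound is asked
only on `Ω`, where `iteratedFDeriv` agrees with that series. -/
theorem hasBddDerivs_of_contDiffOn_closure (hΩ : IsOpen Ω) (hb : Bornology.IsBounded Ω) {m : ℕ}
    {c : Space d → ℝ} (h : ContDiffOn ℝ m c (closure Ω)) : HasBddDerivs Ω m c := by
  refine ⟨h.mono subset_closure, fun n hn => ?_⟩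
  have hcomp : IsCompact (closure Ω) := hb.isCompact_closure
  suffices H : ∃ K, ∀ x ∈ closure Ω ∩ Ω, ‖iteratedFDeriv ℝ n c x‖ ≤ K by
    obtain ⟨K, hK⟩ := H
    exact ⟨K, fun x hx => hK x ⟨subset_closure hx, hx⟩⟩
  refine hcomp.induction_on (p := fun s => ∃ K, ∀ x ∈ s ∩ Ω, ‖iteratedFDeriv ℝ n c x‖ ≤ K)
    ⟨0, by simp⟩ ?_ ?_ ?_
  · rintro s t hst ⟨K, hK⟩
    exact ⟨K, fun x hx => hK x ⟨hst hx.1, hx.2⟩⟩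
  · rintro s t ⟨K, hK⟩ ⟨K', hK'⟩
    refine ⟨max K K', fun x hx => ?_⟩
    rcases hx.1 with h1 | h1
    · exact (hK x ⟨h1, hx.2⟩).trans (le_max_left _ _)
    · exact (hK' x ⟨h1, hx.2⟩).trans (le_max_right _ _)
  · intro x hx
    obtain ⟨s, hs, q, hq⟩ := contDiffWithinAt_nat.1 (h x hx)
    rw [Set.insert_eq_of_mem hx] at hs
    have hxs : x ∈ s := mem_of_mem_nhdsWithin hx hs
    have hcont : ContinuousWithinAt (fun y => ‖q y n‖) s x :=
      (hq.cont n (by exact_mod_cast hn) x hxs).norm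
    have hev : ∀ᶠ y in 𝓝[closure Ω] x, ‖q y n‖ < ‖q x n‖ + 1 :=
      (nhdsWithin_le_of_mem hs) (hcont.eventually (gt_mem_nhds (lt_add_one _)))
    obtain ⟨O, hO, hxO, hOs⟩ := mem_nhdsWithin.1 hs
    refine ⟨{y | ‖q y n‖ < ‖q x n‖ + 1} ∩ O,
      inter_mem hev (mem_nhdsWithin_of_mem_nhds (hO.mem_nhds hxO)), ‖q x n‖ + 1, ?_⟩
    rintro y ⟨⟨hy1, hy2⟩, hyΩ⟩
    have hop : IsOpen (O ∩ Ω) := hO.inter hΩ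
    have hq' : HasFTaylorSeriesUpToOn m c q (O ∩ Ω) :=
      hq.mono ((Set.inter_subset_inter_right O subset_closure).trans hOs)
    have e1 := hq'.eq_iteratedFDerivWithin_of_uniqueDiffOn (m := n) (by exact_mod_cast hn)
      hop.uniqueDiffOn ⟨hy2, hyΩ⟩
    rw [iteratedFDerivWithin_of_isOpen n hop ⟨hy2, hyΩ⟩] at e1
    rw [← e1]
    exact le_of_lt hy1

/-- The Leibniz rule for the product of a `C¹` function and a weakly differentiable function. -/
theorem HasWeakPartial.bddMul [IsFiniteMeasure (volume.restrict Ω)]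
    (hΩ : IsOpen Ω) {i : Fin d} {u v : L2 Ω} (h : HasWeakPartial Ω i u v) {c : Space d → ℝ}
    (hc : ContDiffOn ℝ 1 c Ω) (h0 : MemLp c ⊤ (volume.restrict Ω))
    (h1 : MemLp (fun x => fderiv ℝ c x (basisVec i)) ⊤ (volume.restrict Ω)) :
    HasWeakPartial Ω i (ElasticWave.bddMul c h0 u)
      (ElasticWave.bddMul _ h1 u + ElasticWave.bddMul c h0 v) := by
  intro φ hφ
  have hsub : tsupport (fun x => φ x * c x) ⊆ tsupport φ := tsupport_mul_subset_left
  -- The product is `C¹` on all of space although `c` is so only in `Ω`: off its support it is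
  -- locally zero.
  have hψ : ContDiff ℝ 1 (fun x => φ x * c x) := by
    refine contDiff_iff_contDiffAt.2 fun x => ?_
    by_cases hx : x ∈ tsupport (fun x => φ x * c x)
    swap
    · exact contDiffAt_const.congr_of_eventuallyEq (notMem_tsupport_iff_eventuallyEq.1 hx)
    exact (hφ.1.of_le (by simp)).contDiffAt.mul (hc.contDiffAt (hΩ.mem_nhds (hφ.2.2 (hsub hx))))
  have key := h.integral_fderiv_smul hΩ hψ hφ.2.1.mul_right (hsub.trans hφ.2.2)
  have i1 := integrable_smul_of_memLp ((hφ.fderiv_basisVec i).memLp (volume.restrict Ω) 2)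
    (ElasticWave.bddMul c h0 u)
  have i2 := integrable_smul_of_memLp (hφ.memLp (volume.restrict Ω) 2) (ElasticWave.bddMul _ h1 u)
  have i3 := integrable_smul_of_memLp (hφ.memLp (volume.restrict Ω) 2) (ElasticWave.bddMul c h0 v)
  have e1 : ∫ x in Ω, fderiv ℝ (fun x => φ x * c x) x (basisVec i) • u x
      = (∫ x in Ω, fderiv ℝ φ x (basisVec i) • ElasticWave.bddMul c h0 u x)
        + ∫ x in Ω, φ x • ElasticWave.bddMul _ h1 u x := by
    rw [← integral_add i1 i2]
    apply integral_congr_ae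
    filter_upwards [coeFn_bddMul c h0 u, coeFn_bddMul _ h1 u,
      ae_restrict_mem hΩ.measurableSet] with x a1 a2 hx
    rw [a1, a2, fderiv_fun_mul (hφ.1.differentiable (by simp) x)
      ((hc.contDiffAt (hΩ.mem_nhds hx)).differentiableAt (by simp))]
    simp only [add_apply, smul_apply, smul_eq_mul,
      smul_smul, ← add_smul]
    congr 1
    ring
  have e2 : ∫ x in Ω, (φ x * c x) • v x = ∫ x in Ω, φ x • ElasticWave.bddMul c h0 v x := by
    apply integral_congr_ae
    filter_upwards [coeFn_bddMul c h0 v] with x a1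
    rw [a1, smul_smul]
  have e3 : ∫ x in Ω, φ x • (ElasticWave.bddMul _ h1 u + ElasticWave.bddMul c h0 v) x
      = (∫ x in Ω, φ x • ElasticWave.bddMul _ h1 u x)
        + ∫ x in Ω, φ x • ElasticWave.bddMul c h0 v x := by
    rw [← integral_add i2 i3]
    apply integral_congr_ae
    filter_upwards [Lp.coeFn_add (ElasticWave.bddMul _ h1 u) (ElasticWave.bddMul c h0 v)]
      with x a1
    rw [a1, Pi.add_apply, smul_add]
  rw [e1, e2] at key
  rw [e3, neg_add, ← key]
  abel

/-! ### Functions with weak derivatives up to a given order -/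

/-- `u` has weak derivatives in `L²(Ω)ᵈ` up to order `k`. -/
def HasWeakDerivs (Ω : Set (Space d)) : ℕ → L2 Ω → Prop
  | 0, _ => True
  | k + 1, u => ∀ i, ∃ v, HasWeakPartial Ω i u v ∧ HasWeakDerivs Ω k v

theorem HasWeakDerivs.of_succ {k : ℕ} {u : L2 Ω} (h : HasWeakDerivs Ω (k + 1) u) :
    HasWeakDerivs Ω k u := by
  induction k generalizing u with
  | zero => trivial
  | succ k ih =>
    intro i
    obtain ⟨v, hv, hv'⟩ := h i
    exact ⟨v, hv, ih hv'⟩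

theorem HasWeakDerivs.add {k : ℕ} {u v : L2 Ω} (hu : HasWeakDerivs Ω k u)
    (hv : HasWeakDerivs Ω k v) : HasWeakDerivs Ω k (u + v) := by
  induction k generalizing u v with
  | zero => trivial
  | succ k ih =>
    intro i
    obtain ⟨u', h1, h1'⟩ := hu i
    obtain ⟨v', h2, h2'⟩ := hv i
    exact ⟨_, h1.add h2, ih h1' h2'⟩

theorem hasWeakDerivs_zero (k : ℕ) : HasWeakDerivs Ω k 0 := by
  induction k with
  | zero => trivial
  | succ k ih => exact fun i => ⟨0, hasWeakPartial_zero i, ih⟩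

theorem HasWeakDerivs.sum {ι : Type*} {k : ℕ} (s : Finset ι) {u : ι → L2 Ω}
    (hu : ∀ a ∈ s, HasWeakDerivs Ω k (u a)) : HasWeakDerivs Ω k (∑ a ∈ s, u a) :=
  Finset.sum_induction _ _ (fun _ _ => HasWeakDerivs.add) (hasWeakDerivs_zero k) hu

theorem HasWeakDerivs.compLp {k : ℕ} {u : L2 Ω} (hu : HasWeakDerivs Ω k u)
    (L : Space d →L[ℝ] Space d) : HasWeakDerivs Ω k (L.compLp u) := by
  induction k generalizing u with
  | zero => trivial
  | succ k ih =>
    intro i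
    obtain ⟨v, hv, hv'⟩ := hu i
    exact ⟨_, hv.compLp L, ih hv'⟩

theorem HasWeakDerivs.bddMul [IsFiniteMeasure (volume.restrict Ω)] (hΩ : IsOpen Ω) {k : ℕ}
    {u : L2 Ω} (hu : HasWeakDerivs Ω k u) {c : Space d → ℝ} (hc : HasBddDerivs Ω k c) :
    HasWeakDerivs Ω k (ElasticWave.bddMul c (hc.memLp_top hΩ) u) := by
  induction k generalizing u c with
  | zero => trivial
  | succ k ih =>
    intro i
    obtain ⟨v, hv, hv'⟩ := hu i
    have hd := hc.fderiv_apply hΩ (basisVec i)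
    exact ⟨_, hv.bddMul hΩ (hc.1.of_le (by simp)) (hc.memLp_top hΩ) (hd.memLp_top hΩ),
      (ih hu.of_succ hd).add (ih hv' (hc.mono k.le_succ))⟩

/-- The weak derivatives of `u` up to order `k` form a family indexed by multi-indices. -/
theorem HasWeakDerivs.exists_jet (hΩ : IsOpen Ω) {k : ℕ} {u : L2 Ω} (hu : HasWeakDerivs Ω k u) :
    ∃ V : (Fin d → ℕ) → L2 Ω, V 0 = u ∧ ∀ α i, ∑ j, α j + 1 ≤ k →
      HasWeakPartial Ω i (V α) (V (α + Pi.single i 1)) := by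
  classical
  induction k generalizing u with
  | zero => exact ⟨fun _ => u, rfl, fun α i h => absurd h (by omega)⟩
  | succ k ih =>
    have sum_single : ∀ (δ : Fin d → ℕ) (i : Fin d),
        ∑ j, (δ + Pi.single i 1 : Fin d → ℕ) j = ∑ j, δ j + 1 := by
      intro δ i
      simp [Finset.sum_add_distrib]
    have exists_eq_add : ∀ (α : Fin d → ℕ) (i : Fin d), α i ≠ 0 →
        α = (α - Pi.single i 1) + Pi.single i 1 := by
      intro α i h
      ext j
      by_cases hj : j = i
      · subst hj
        simp
        omega
      · simp [hj]
    choose g hg hgk using hu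
    choose V hV0 hV using fun i => ih (hgk i)
    -- The families built from different first derivatives are compatible. For `δ = 0` this is the
    -- commutation of weak derivatives; a larger `δ` follows by differentiating once more and using
    -- uniqueness.
    have symm : ∀ n (δ : Fin d → ℕ), ∑ j, δ j = n → n + 1 ≤ k → ∀ i j,
        V i (δ + Pi.single j 1) = V j (δ + Pi.single i 1) := by
      intro n
      induction n with
      | zero =>
        intro δ hδ hk i j
        have hδ0 : δ = 0 := by
          ext j
          simpa using (Finset.sum_eq_zero_iff.1 hδ) j (Finset.mem_univ j)
        subst hδ0
        have a1 := hV i 0 j (by simpa using hk)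
        have a2 := hV j 0 i (by simpa using hk)
        rw [hV0] at a1 a2
        exact (hg i).comm hΩ a1 (hg j) a2
      | succ n ihn =>
        intro δ hδ hk i j
        obtain ⟨m, hm⟩ : ∃ m, δ m ≠ 0 := by
          by_contra! h
          simp [h] at hδ
        rw [exists_eq_add δ m hm] at hδ ⊢
        set ε := δ - Pi.single m 1
        rw [sum_single] at hδ
        have hε : ∑ j, ε j = n := by omega
        have a1 := hV i (ε + Pi.single j 1) m (by rw [sum_single]; omega)
        have a2 := hV j (ε + Pi.single i 1) m (by rw [sum_single]; omega)
        rw [ihn ε hε (by omega) i j] at a1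
        rw [add_right_comm ε _ (Pi.single j 1), add_right_comm ε _ (Pi.single i 1)]
        exact a1.unique hΩ a2
    -- One factor is peeled off `α` along an arbitrarily chosen nonzero coordinate; `symm` makes the
    -- result independent of the choice.
    let V' : (Fin d → ℕ) → L2 Ω := fun α =>
      if h : ∃ i, α i ≠ 0 then V h.choose (α - Pi.single h.choose 1) else u
    have hV' : ∀ α i, ∑ j, α j ≤ k → V' (α + Pi.single i 1) = V i α := by
      intro α i hα
      have h : ∃ m, (α + Pi.single i 1 : Fin d → ℕ) m ≠ 0 := ⟨i, by simp⟩
      have hval : V' (α + Pi.single i 1)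
          = V h.choose (α + Pi.single i 1 - Pi.single h.choose 1) := dif_pos h
      rw [hval]
      have hm := h.choose_spec
      set m := h.choose
      by_cases hmi : m = i
      · rw [hmi, add_tsub_cancel_right]
      · have hαm : α m ≠ 0 := by simpa [hmi] using hm
        rw [exists_eq_add α m hαm] at hα ⊢
        rw [sum_single] at hα
        rw [add_right_comm, add_tsub_cancel_right]
        exact symm _ _ rfl hα m i
    refine ⟨V', dif_neg (by simp), fun α i hα => ?_⟩
    rw [hV' α i (by omega)]
    by_cases h : ∃ m, α m ≠ 0
    · obtain ⟨m, hm⟩ := h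
      rw [exists_eq_add α m hm] at hα ⊢
      rw [sum_single] at hα
      rw [hV' _ m (by omega), ← hV' _ i (by rw [sum_single]; omega), add_right_comm,
        hV' _ m (by rw [sum_single]; omega)]
      exact hV m _ i (by omega)
    · have hα0 : α = 0 := by
        ext m
        by_contra hm
        exact h ⟨m, hm⟩
      subst hα0
      have : V' 0 = u := dif_neg (by simp)
      rw [this, hV0]
      exact hg i

end WeakPartial

/-! ### Weak time derivatives: closedness of second order equations -/

section SecondOrder

variable {X Y : Type*} [NormedAddCommGroup X] [NormedSpace ℝ X] [NormedAddCommGroup Y]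
  [NormedSpace ℝ Y] {T : ℝ}

theorem HasWeakTimeDeriv.congr_left {u u' v : ℝ → Y} (h : HasWeakTimeDeriv T u v)
    (hu : u =ᵐ[timeMeasure T] u') : HasWeakTimeDeriv T u' v := by
  intro φ hφ
  rw [← h φ hφ]
  apply integral_congr_ae
  filter_upwards [hu] with t ht
  rw [ht]

variable [CompleteSpace Y]

/-- The solutions `u` of `(B u)'' = A u`, in the form of a weak equation. -/
theorem exists_weakTimeDeriv_iff (hT : 0 < T) (A B : X →L[ℝ] Y) (u : Lp X 2 (timeMeasure T)) :
    (∃ v w : Lp Y 2 (timeMeasure T), HasWeakTimeDeriv T (fun t => B (u t)) v ∧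
      HasWeakTimeDeriv T v w ∧ ∀ᵐ t ∂timeMeasure T, w t = A (u t)) ↔
    ∀ (φ : ℝ → ℝ) (h : IsTestFunction (Set.Ioo 0 T) φ),
      pairing _ (h.deriv_isTestFunction.deriv_isTestFunction.memLp (timeMeasure T) 2)
        (B.compLpL 2 _ u) = pairing _ (h.memLp (timeMeasure T) 2) (A.compLpL 2 _ u) := by
  simp only [pairing_apply]
  constructor
  · rintro ⟨v, w, hv, hw, hA⟩ φ hφ
    have e1 := (hv.congr_left (B.coeFn_compLp' u).symm) _ hφ.deriv_isTestFunction
    have e2 := hw φ hφ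
    rw [e2, neg_neg] at e1
    refine e1.trans (integral_congr_ae ?_)
    filter_upwards [hA, A.coeFn_compLpL (p := 2) (μ := timeMeasure T) u] with t h1 h2
    rw [h1, h2]
  · intro h
    obtain ⟨v, hv, hw⟩ := exists_weakTimeDeriv hT (B.compLpL 2 _ u) (A.compLpL 2 _ u) h
    exact ⟨v, A.compLpL 2 _ u, hv.congr_left (B.coeFn_compLpL u), hw, A.coeFn_compLpL u⟩

/-- By the weak form the set is an intersection, over test functions, of sets where two continuous
linear maps agree. -/
theorem isClosed_convex_setOf_weakTimeDeriv (hT : 0 < T) (A B : X →L[ℝ] Y) :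
    IsClosed {u : Lp X 2 (timeMeasure T) | ∃ v w : Lp Y 2 (timeMeasure T),
      HasWeakTimeDeriv T (fun t => B (u t)) v ∧ HasWeakTimeDeriv T v w ∧
        ∀ᵐ t ∂timeMeasure T, w t = A (u t)} ∧
    Convex ℝ {u : Lp X 2 (timeMeasure T) | ∃ v w : Lp Y 2 (timeMeasure T),
      HasWeakTimeDeriv T (fun t => B (u t)) v ∧ HasWeakTimeDeriv T v w ∧
        ∀ᵐ t ∂timeMeasure T, w t = A (u t)} := by
  simp only [exists_weakTimeDeriv_iff hT, Set.ofPred_forall]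
  constructor
  · exact isClosed_iInter fun φ => isClosed_iInter fun hφ => isClosed_eq (by fun_prop) (by fun_prop)
  · refine convex_iInter fun φ => convex_iInter fun hφ => ?_
    intro u hu v hv a b _ _ _
    simp only [Set.mem_ofPred_eq] at hu hv ⊢
    simp only [map_add, map_smul, hu, hv]

end SecondOrder

/-! ### Sobolev spaces -/

section Sobolev

variable {d : ℕ} {Ω : Set (Space d)}

/-- The weak derivative `u ↦ D^α u` as a bounded operator. -/
def derivL (Ω : Set (Space d)) (k : ℕ) (α : Fin d → ℕ) : Sobolev Ω k →L[ℝ] L2 Ω :=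
  if h : α ∈ multiIndices d k then
    (PiLp.proj (𝕜 := ℝ) 2 (fun _ : multiIndices d k => L2 Ω) ⟨α, h⟩).comp (Sobolev Ω k).subtypeL
  else 0

theorem derivL_apply {k : ℕ} (α : Fin d → ℕ) (u : Sobolev Ω k) :
    derivL Ω k α u = Sobolev.D u α := by
  by_cases h : α ∈ multiIndices d k
  · rw [derivL, Sobolev.D, dif_pos h, dif_pos h]
    rfl
  · rw [derivL, Sobolev.D, dif_neg h, dif_neg h]
    rfl

theorem Sobolev.hasWeakPartial_D {k : ℕ} (u : Sobolev Ω k) {α : Fin d → ℕ} (i : Fin d)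
    (h : ∑ j, α j + 1 ≤ k) :
    HasWeakPartial Ω i (Sobolev.D u α) (Sobolev.D u (α + Pi.single i 1)) := by
  have h1 : α ∈ multiIndices d k := mem_multiIndices.2 (by omega)
  have h2 : α + Pi.single i 1 ∈ multiIndices d k :=
    mem_multiIndices.2 (by simpa [Finset.sum_add_distrib] using h)
  rw [Sobolev.D, Sobolev.D, dif_pos h1, dif_pos h2]
  exact u.2 ⟨α, h1⟩ ⟨_, h2⟩ i rfl

theorem Sobolev.hasWeakDerivs_D {k : ℕ} (u : Sobolev Ω k) (m : ℕ) {α : Fin d → ℕ}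
    (h : ∑ j, α j + m ≤ k) : HasWeakDerivs Ω m (Sobolev.D u α) := by
  induction m generalizing α with
  | zero => trivial
  | succ m ih =>
    intro i
    refine ⟨_, Sobolev.hasWeakPartial_D u i (by omega), ih ?_⟩
    simp only [Pi.add_apply, Finset.sum_add_distrib, Finset.sum_pi_single', Finset.mem_univ, if_true]
    omega

/-- An element of `Hᵏ(Ω)ᵈ` is determined by the underlying function. -/
theorem Sobolev.ext_D_zero (hΩ : IsOpen Ω) {k : ℕ} {u v : Sobolev Ω k}
    (h : Sobolev.D u 0 = Sobolev.D v 0) : u = v := by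
  have key : ∀ n (α : Fin d → ℕ), ∑ j, α j = n → n ≤ k → Sobolev.D u α = Sobolev.D v α := by
    intro n
    induction n with
    | zero =>
      intro α hα _
      have : α = 0 := by
        ext j
        simpa using (Finset.sum_eq_zero_iff.1 hα) j (Finset.mem_univ j)
      rw [this, h]
    | succ n ih =>
      intro α hα hn
      obtain ⟨m, hm⟩ : ∃ m, α m ≠ 0 := by
        by_contra! h
        simp [h] at hα
      obtain ⟨β, rfl⟩ : ∃ β : Fin d → ℕ, α = β + Pi.single m 1 := by
        refine ⟨α - Pi.single m 1, (tsub_add_cancel_of_le fun j => ?_).symm⟩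
        by_cases hj : j = m
        · subst hj
          simp
          omega
        · simp [hj]
      have hβ : ∑ j, β j = n := by
        simp [Finset.sum_add_distrib] at hα
        omega
      have h1 := Sobolev.hasWeakPartial_D u m (α := β) (by omega)
      rw [ih β hβ (by omega)] at h1
      exact h1.unique hΩ (Sobolev.hasWeakPartial_D v m (by omega))
  apply Subtype.ext
  ext1 α
  have := key _ α.1 rfl (mem_multiIndices.1 α.2)
  rw [Sobolev.D, Sobolev.D, dif_pos α.2, dif_pos α.2] at this
  exact this

/-- Passes from the recursive notion, convenient for the Leibniz rule, to jets indexed by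
multi-indices. -/
theorem HasWeakDerivs.exists_sobolev (hΩ : IsOpen Ω) {k : ℕ} {u : L2 Ω}
    (hu : HasWeakDerivs Ω k u) : ∃ U : Sobolev Ω k, Sobolev.D U 0 = u := by
  obtain ⟨V, hV0, hV⟩ := hu.exists_jet hΩ
  refine ⟨⟨WithLp.toLp 2 fun α => V α.1, ?_⟩, ?_⟩
  · rintro ⟨α, hα⟩ ⟨β, hβ⟩ i hαβ
    simp only at hαβ
    subst hαβ
    have := mem_multiIndices.1 hβ
    simp [Finset.sum_add_distrib] at this
    exact hV α i this
  · rw [Sobolev.D, dif_pos (mem_multiIndices.2 (by simp))]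
    exact hV0

/-- The inclusion `H^{2+p}(Ω)ᵈ → H^p(Ω)ᵈ` as a bounded operator. -/
def inclL (Ω : Set (Space d)) (p : ℕ) : Sobolev Ω (2 + p) →L[ℝ] Sobolev Ω p where
  toFun := Sobolev.incl
  map_add' _ _ := rfl
  map_smul' _ _ := rfl
  cont := by
    refine Continuous.subtype_mk ?_ _
    refine (PiLp.continuous_toLp 2 _).comp (continuous_pi fun α => ?_)
    exact (PiLp.continuous_apply 2 _ _).comp continuous_subtype_val

/-! ### Traces -/

/-- `R` is linear on smooth functions. -/
def IsLinearOnSmooth (R : (Space d → Space d) → Space d → Space d) : Prop :=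
  ∀ φ ψ : Space d → Space d, ContDiff ℝ ∞ φ → ContDiff ℝ ∞ ψ → ∀ a b : ℝ,
    R (a • φ + b • ψ) = a • R φ + b • R ψ

theorem tendstoL2_iff {μ : Measure (Space d)} {F : ℕ → Space d → Space d} {f : Space d → Space d}
    (hF : ∀ n, MemLp (F n) 2 μ) (hf : MemLp f 2 μ) :
    TendstoL2 μ F f ↔ Tendsto (fun n => (hF n).toLp (F n)) atTop (𝓝 (hf.toLp f)) := by
  rw [Lp.tendsto_Lp_iff_tendsto_eLpNorm'']
  exact ⟨fun h => h.2.2, fun h => ⟨hF, hf, h⟩⟩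

/-- A countable product of `L²` spaces is first countable, so limits of sequences of smooth data
make up the whole closure. -/
theorem tendstoL2_iff_mem_closure {ι : Type*} [Countable ι] (μ : ι → Measure (Space d))
    (R : ι → (Space d → Space d) → Space d → Space d) (h : ∀ a, Lp (Space d) 2 (μ a)) :
    (∃ φ : ℕ → Space d → Space d, (∀ n, ContDiff ℝ ∞ (φ n)) ∧
      ∀ a, TendstoL2 (μ a) (fun n => R a (φ n)) (h a)) ↔
    h ∈ closure {g : ∀ a, Lp (Space d) 2 (μ a) | ∃ φ : Space d → Space d, ContDiff ℝ ∞ φ ∧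
      ∀ a, g a =ᵐ[μ a] R a φ} := by
  rw [mem_closure_iff_seq_limit]
  constructor
  · rintro ⟨φ, hφ, hR⟩
    refine ⟨fun n a => ((hR a).1 n).toLp _, fun n => ⟨φ n, hφ n, fun a => ((hR a).1 n).coeFn_toLp⟩,
      tendsto_pi_nhds.2 fun a => ?_⟩
    have := (tendstoL2_iff (hR a).1 (Lp.memLp (h a))).1 (hR a)
    rwa [Lp.toLp_coeFn] at this
  · rintro ⟨g, hg, hlim⟩
    choose φ hφ hgφ using hg
    refine ⟨φ, hφ, fun a => ?_⟩
    have hm : ∀ n, MemLp (R a (φ n)) 2 (μ a) := fun n =>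
      (memLp_congr_ae (hgφ n a)).1 (Lp.memLp (g n a))
    rw [tendstoL2_iff hm (Lp.memLp (h a)), Lp.toLp_coeFn]
    refine (tendsto_pi_nhds.1 hlim a).congr fun n => ?_
    rw [← Lp.toLp_coeFn (g n a) (Lp.memLp _)]
    exact MemLp.toLp_congr _ _ (hgφ n a)

theorem convex_smooth_image {ι : Type*} (μ : ι → Measure (Space d))
    (R : ι → (Space d → Space d) → Space d → Space d) (hR : ∀ a, IsLinearOnSmooth (R a)) :
    Convex ℝ {g : ∀ a, Lp (Space d) 2 (μ a) | ∃ φ : Space d → Space d, ContDiff ℝ ∞ φ ∧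
      ∀ a, g a =ᵐ[μ a] R a φ} := by
  rintro g ⟨φ, hφ, hg⟩ g' ⟨ψ, hψ, hg'⟩ s t _ _ _
  refine ⟨s • φ + t • ψ, (hφ.const_smul s).add (hψ.const_smul t), fun a => ?_⟩
  rw [hR a φ ψ hφ hψ]
  filter_upwards [hg a, hg' a, Lp.coeFn_add (s • g a) (t • g' a), Lp.coeFn_smul s (g a),
    Lp.coeFn_smul t (g' a)] with x h1 h2 h3 h4 h5
  simp only [Pi.add_apply, Pi.smul_apply] at h3 h4 h5 ⊢
  rw [h3, h4, h5, h1, h2]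

theorem TendstoL2.congr_right {μ : Measure (Space d)} {F : ℕ → Space d → Space d}
    {f f' : Space d → Space d} (h : TendstoL2 μ F f) (hf : f =ᵐ[μ] f') : TendstoL2 μ F f' := by
  refine ⟨h.1, (memLp_congr_ae hf).1 h.2.1, h.2.2.congr fun n => eLpNorm_congr_ae ?_⟩
  filter_upwards [hf] with x hx
  rw [hx]

/-- The functions `u ∈ Hᵏ(Ω)ᵈ` that are limits of smooth functions `φₙ` with given boundary
values form a closed convex set. -/
theorem isClosed_convex_setOf_tendstoL2 {J : Type*} [Countable J] (k : ℕ) (σ : Measure (Space d))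
    (R : J → (Space d → Space d) → Space d → Space d) (hR : ∀ a, IsLinearOnSmooth (R a))
    (α : J → Fin d → ℕ) (B : (Space d → Space d) → Space d → Space d) (hB : IsLinearOnSmooth B)
    (f : Space d → Space d) {P : Sobolev Ω k → Prop}
    (hP : ∀ u, P u ↔ ∃ φ : ℕ → Space d → Space d, (∀ n, ContDiff ℝ ∞ (φ n)) ∧
      (∀ a, TendstoL2 (volume.restrict Ω) (fun n => R a (φ n)) (Sobolev.D u (α a))) ∧
        TendstoL2 σ (fun n => B (φ n)) f) :
    IsClosed {u | P u} ∧ Convex ℝ {u | P u} := by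
  by_cases hf : MemLp f 2 σ
  swap
  · have : {u | P u} = ∅ := Set.eq_empty_of_forall_notMem fun u hu => by
      obtain ⟨_, _, _, h⟩ := (hP u).1 hu
      exact hf h.2.1
    rw [this]
    exact ⟨isClosed_empty, convex_empty⟩
  -- The extra index `none` carries the boundary data, so interior derivatives and boundary values
  -- are approximated by the same smooth sequence.
  let μ : Option J → Measure (Space d) := fun a => a.elim σ fun _ => volume.restrict Ω
  let R' : Option J → (Space d → Space d) → Space d → Space d := fun a => a.elim B R
  have hR' : ∀ a, IsLinearOnSmooth (R' a) := by
    rintro (_ | a)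
    exacts [hB, hR a]
  let Φ : Sobolev Ω k → ∀ a, Lp (Space d) 2 (μ a) := fun u a =>
    match a with
    | none => hf.toLp f
    | some a => derivL Ω k (α a) u
  have hΦ : Continuous Φ := by
    refine continuous_pi ?_
    rintro (_ | a)
    · exact continuous_const
    · exact (derivL Ω k (α a)).continuous
  have hset : {u | P u}
      = Φ ⁻¹' closure {g : ∀ a, Lp (Space d) 2 (μ a) | ∃ φ : Space d → Space d,
        ContDiff ℝ ∞ φ ∧ ∀ a, g a =ᵐ[μ a] R' a φ} := by
    ext u
    rw [Set.mem_preimage, ← tendstoL2_iff_mem_closure, Set.mem_ofPred_eq, hP]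
    refine exists_congr fun φ => and_congr_right fun _ => ?_
    rw [Option.forall, and_comm]
    refine and_congr ⟨fun h => h.congr_right hf.coeFn_toLp.symm,
      fun h => h.congr_right hf.coeFn_toLp⟩ (forall_congr' fun a => ?_)
    rw [← derivL_apply]
    rfl
  rw [hset]
  refine ⟨isClosed_closure.preimage hΦ, ?_⟩
  intro u hu v hv s t hs ht hst
  have : Φ (s • u + t • v) = s • Φ u + t • Φ v := by
    ext1 a
    rcases a with _ | a
    -- The boundary component of `Φ` is constant, so `Φ` is affine rather than linear; `s + t = 1`
    -- is used here.
    · change hf.toLp f = s • hf.toLp f + t • hf.toLp f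
      rw [← add_smul, hst, one_smul]
    · change derivL Ω k (α a) (s • u + t • v) = s • derivL Ω k (α a) u + t • derivL Ω k (α a) v
      rw [map_add, map_smul, map_smul]
  rw [Set.mem_preimage, this]
  exact (convex_smooth_image μ R' hR').closure hu hv hs ht hst

theorem isLinearOnSmooth_id : IsLinearOnSmooth (d := d) id := fun _ _ _ _ _ _ => rfl

theorem isLinearOnSmooth_fderiv (e : Space d → Space d) :
    IsLinearOnSmooth fun φ x => fderiv ℝ φ x (e x) := by
  intro φ ψ hφ hψ a b
  ext1 x
  have h1 := hφ.differentiable (by simp) x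
  have h2 := hψ.differentiable (by simp) x
  change fderiv ℝ (a • φ + b • ψ) x (e x) = a • fderiv ℝ φ x (e x) + b • fderiv ℝ ψ x (e x)
  rw [fderiv_add (h1.const_smul a) (h2.const_smul b), fderiv_const_smul h1, fderiv_const_smul h2]
  rfl

theorem isLinearOnSmooth_pderiv (i : Fin d) : IsLinearOnSmooth (pderiv i) :=
  isLinearOnSmooth_fderiv fun _ => basisVec i

theorem contDiff_pderiv {φ : Space d → Space d} (h : ContDiff ℝ ∞ φ) (i : Fin d) :
    ContDiff ℝ ∞ (pderiv i φ) :=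
  (h.fderiv_right (m := ∞) (by simp)).clm_apply contDiff_const

theorem isLinearOnSmooth_pderiv_pderiv (i j : Fin d) :
    IsLinearOnSmooth fun φ => pderiv j (pderiv i φ) := by
  intro φ ψ hφ hψ a b
  simp only [isLinearOnSmooth_pderiv i φ ψ hφ hψ a b]
  exact isLinearOnSmooth_pderiv j _ _ (contDiff_pderiv hφ i) (contDiff_pderiv hψ i) a b

theorem isClosed_convex_setOf_hasTrace (k : ℕ) (f : Space d → Space d) :
    IsClosed {u : Sobolev Ω k | HasTrace u f} ∧ Convex ℝ {u : Sobolev Ω k | HasTrace u f} := by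
  refine isClosed_convex_setOf_tendstoL2 (J := Option (Fin d)) k (surfaceMeasure Ω)
    (fun a => a.elim id pderiv)
    (by rintro (_ | i); exacts [isLinearOnSmooth_id, isLinearOnSmooth_pderiv i])
    (fun a => a.elim 0 fun i => Pi.single i 1) id isLinearOnSmooth_id f fun u => ?_
  refine exists_congr fun φ => ?_
  rw [TendstoH1, and_assoc]
  refine and_congr_right fun _ => and_congr_left fun _ => ?_
  rw [Option.forall]
  rfl

theorem isClosed_convex_setOf_hasNormalTrace (k : ℕ) (g : Space d → Space d) :
    IsClosed {u : Sobolev Ω k | HasNormalTrace u g} ∧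
      Convex ℝ {u : Sobolev Ω k | HasNormalTrace u g} := by
  refine isClosed_convex_setOf_tendstoL2 (J := Option (Fin d) ⊕ Fin d × Fin d) k
    (surfaceMeasure Ω)
    (Sum.elim (fun a => a.elim id pderiv) fun a φ => pderiv a.2 (pderiv a.1 φ))
    (by
      rintro ((_ | i) | a)
      exacts [isLinearOnSmooth_id, isLinearOnSmooth_pderiv i,
        isLinearOnSmooth_pderiv_pderiv a.1 a.2])
    (Sum.elim (fun a => a.elim 0 fun i => Pi.single i 1)
      fun a => Pi.single a.1 1 + Pi.single a.2 1)
    (fun φ x => fderiv ℝ φ x (outwardNormal Ω x)) (isLinearOnSmooth_fderiv _) g fun u => ?_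
  refine exists_congr fun φ => ?_
  rw [TendstoH2, TendstoH1, and_assoc, and_assoc]
  refine and_congr_right fun _ => ?_
  rw [← and_assoc]
  refine and_congr_left fun _ => ?_
  rw [Sum.forall, Option.forall, Prod.forall]
  rfl

end Sobolev

/-! ### The elasticity operator -/

section Elasticity

variable {d : ℕ} {Ω : Set (Space d)}

/-- The matrix unit `v ↦ v_k eᵢ`. -/
def matrixUnit (i k : Fin d) : Space d →L[ℝ] Space d :=
  (EuclideanSpace.proj k : Space d →L[ℝ] ℝ).smulRight (basisVec i)

theorem matrixUnit_apply (i k : Fin d) (v : Space d) (a : Fin d) :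
    matrixUnit i k v a = if a = i then v k else 0 := by
  simp [matrixUnit, basisVec]

/-- The `j`-th column `((C : ∇u)_ij)_i` of the stress. -/
def stressColumn {C : Space d → Fin d → Fin d → Fin d → Fin d → ℝ}
    (hC : ∀ i j k l, MemLp (fun x => C x i j k l) ⊤ (volume.restrict Ω)) (m : ℕ) (j : Fin d) :
    Sobolev Ω m →L[ℝ] L2 Ω :=
  ∑ z : Fin d × Fin d × Fin d, (bddMul _ (hC z.1 j z.2.1 z.2.2)).comp
    (((matrixUnit z.1 z.2.1).compLpL 2 _).comp (derivL Ω m (Pi.single z.2.2 1)))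

theorem stressColumn_apply {C : Space d → Fin d → Fin d → Fin d → Fin d → ℝ}
    (hC : ∀ i j k l, MemLp (fun x => C x i j k l) ⊤ (volume.restrict Ω)) {m : ℕ} (j : Fin d)
    (u : Sobolev Ω m) :
    stressColumn hC m j u = ∑ z : Fin d × Fin d × Fin d, bddMul _ (hC z.1 j z.2.1 z.2.2)
      ((matrixUnit z.1 z.2.1).compLp (Sobolev.D u (Pi.single z.2.2 1))) := by
  rw [stressColumn, sum_apply]
  simp only [← derivL_apply]
  rfl

theorem coeFn_stressColumn {C : Space d → Fin d → Fin d → Fin d → Fin d → ℝ}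
    (hC : ∀ i j k l, MemLp (fun x => C x i j k l) ⊤ (volume.restrict Ω)) {m : ℕ} (j : Fin d)
    (u : Sobolev Ω m) :
    ∀ᵐ x ∂volume.restrict Ω, ∀ i, stressColumn hC m j u x i = stress C u x i j := by
  rw [stressColumn_apply]
  have h1 : ∀ᵐ x ∂volume.restrict Ω, ∀ z : Fin d × Fin d × Fin d,
      bddMul _ (hC z.1 j z.2.1 z.2.2)
        ((matrixUnit z.1 z.2.1).compLp (Sobolev.D u (Pi.single z.2.2 1))) x
      = C x z.1 j z.2.1 z.2.2 • matrixUnit z.1 z.2.1 (Sobolev.D u (Pi.single z.2.2 1) x) := by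
    refine ae_all_iff.2 fun z => ?_
    filter_upwards [coeFn_bddMul _ (hC z.1 j z.2.1 z.2.2)
      ((matrixUnit z.1 z.2.1).compLp (Sobolev.D u (Pi.single z.2.2 1))),
      (matrixUnit z.1 z.2.1).coeFn_compLp (Sobolev.D u (Pi.single z.2.2 1))] with x a1 a2
    rw [a1, a2]
  filter_upwards [h1, Lp.coeFn_finsetSum Finset.univ fun z : Fin d × Fin d × Fin d =>
    bddMul _ (hC z.1 j z.2.1 z.2.2)
      ((matrixUnit z.1 z.2.1).compLp (Sobolev.D u (Pi.single z.2.2 1)))] with x a1 a2 i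
  rw [a2, Finset.sum_apply, WithLp.ofLp_sum, Finset.sum_apply]
  simp only [a1, PiLp.smul_apply, matrixUnit_apply, smul_eq_mul, mul_ite, mul_zero]
  rw [Fintype.sum_prod_type, Finset.sum_eq_single i (fun b _ hb => by simp [hb.symm])
    (fun h => absurd (Finset.mem_univ i) h), Fintype.sum_prod_type]
  simp [stress]

theorem integral_smul_apply {ψ : Space d → ℝ} (hψ : MemLp ψ 2 (volume.restrict Ω)) (u : L2 Ω)
    (i : Fin d) : (∫ x in Ω, ψ x • u x) i = ∫ x in Ω, ψ x * u x i :=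
  ((EuclideanSpace.proj (𝕜 := ℝ) i : Space d →L[ℝ] ℝ).integral_comp_comm
    (integrable_smul_of_memLp hψ u)).symm

/-- Collecting the scalar equations into one vector equation writes the divergence as continuous
linear functionals of the stress columns. -/
theorem hasWeakDiv_stress_iff {C : Space d → Fin d → Fin d → Fin d → Fin d → ℝ}
    (hC : ∀ i j k l, MemLp (fun x => C x i j k l) ⊤ (volume.restrict Ω)) {m : ℕ}
    (u : Sobolev Ω m) (w : L2 Ω) :
    HasWeakDiv Ω (stress C u) w ↔ ∀ (φ : Space d → ℝ) (h : IsTestFunction Ω φ),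
      ∑ j, pairing _ ((h.fderiv_basisVec j).memLp (volume.restrict Ω) 2) (stressColumn hC m j u)
        = -pairing _ (h.memLp (volume.restrict Ω) 2) w := by
  refine forall_congr' fun φ => forall_congr' fun hφ => ?_
  rw [← (WithLp.equiv 2 (Fin d → ℝ)).injective.eq_iff, funext_iff]
  refine forall_congr' fun i => ?_
  simp only [WithLp.equiv_apply, WithLp.ofLp_sum, WithLp.ofLp_neg, Finset.sum_apply, Pi.neg_apply,
    pairing_apply]
  rw [integral_smul_apply (hφ.memLp _ 2)]
  simp only [fun j => integral_smul_apply ((hφ.fderiv_basisVec j).memLp (volume.restrict Ω) 2)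
    (stressColumn hC m j u) i]
  have hint : ∀ j, Integrable (fun x => fderiv ℝ φ x (basisVec j) * stressColumn hC m j u x i)
      (volume.restrict Ω) := fun j =>
    (EuclideanSpace.proj (𝕜 := ℝ) i : Space d →L[ℝ] ℝ).integrable_comp
      (integrable_smul_of_memLp ((hφ.fderiv_basisVec j).memLp (volume.restrict Ω) 2)
        (stressColumn hC m j u))
  rw [← integral_finsetSum _ fun j _ => hint j]
  have e1 : ∫ x in Ω, ∑ j, stress C u x i j * fderiv ℝ φ x (basisVec j)
      = ∫ x in Ω, ∑ j, fderiv ℝ φ x (basisVec j) * stressColumn hC m j u x i := by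
    apply integral_congr_ae
    filter_upwards [ae_all_iff.2 fun j => coeFn_stressColumn hC j u] with x hx
    refine Finset.sum_congr rfl fun j _ => ?_
    rw [hx, mul_comm]
  rw [e1]
  simp only [mul_comm (φ _)]

/-- The operator `u ↦ div (C : ∇u)` is bounded from `H^{2+p}(Ω)ᵈ` to `H^p(Ω)ᵈ`. -/
theorem exists_elasticityOperator (hΩ : IsOpen Ω) [IsFiniteMeasure (volume.restrict Ω)] (p : ℕ)
    {C : Space d → Fin d → Fin d → Fin d → Fin d → ℝ}
    (hC : ∀ i j k l, HasBddDerivs Ω (p + 1) fun x => C x i j k l) :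
    ∃ A : Sobolev Ω (2 + p) →L[ℝ] Sobolev Ω p, ∀ (u : Sobolev Ω (2 + p)) (w : Sobolev Ω p),
      HasWeakDiv Ω (stress C u) (Sobolev.D w 0) ↔ w = A u := by
  have hC' := fun i j k l => (hC i j k l).memLp_top hΩ
  simp only [hasWeakDiv_stress_iff hC', ← derivL_apply]
  set G : Sobolev Ω (2 + p) → Sobolev Ω p → Prop := fun u w =>
    ∀ (φ : Space d → ℝ) (h : IsTestFunction Ω φ),
      ∑ j, pairing _ ((h.fderiv_basisVec j).memLp (volume.restrict Ω) 2)
        (stressColumn hC' (2 + p) j u)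
        = -pairing _ (h.memLp (volume.restrict Ω) 2) (derivL Ω p 0 w) with hG
  change ∃ A : Sobolev Ω (2 + p) →L[ℝ] Sobolev Ω p, ∀ u w, G u w ↔ w = A u
  have hex : ∀ u, ∃ w, G u w := by
    intro u
    -- First derivatives of `u` have `p + 1` derivatives left, matching the smoothness of `C`; the
    -- divergence uses up one and leaves `p`.
    have hcol : ∀ j, HasWeakDerivs Ω (p + 1) (stressColumn hC' (2 + p) j u) := by
      intro j
      rw [stressColumn_apply]
      refine HasWeakDerivs.sum _ fun z _ => HasWeakDerivs.bddMul hΩ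
        (HasWeakDerivs.compLp (Sobolev.hasWeakDerivs_D u (p + 1) ?_) _) (hC _ _ _ _)
      simp
      omega
    choose v hv hv' using fun j => hcol j j
    obtain ⟨w, hw⟩ := (HasWeakDerivs.sum Finset.univ fun j _ => hv' j).exists_sobolev hΩ
    refine ⟨w, fun φ hφ => ?_⟩
    rw [derivL_apply, hw, map_sum, ← Finset.sum_neg_distrib]
    exact Finset.sum_congr rfl fun j _ => hasWeakPartial_iff.1 (hv j) φ hφ
  have huniq : ∀ u w w', G u w → G u w' → w = w' := by
    intro u w w' h h'
    refine Sobolev.ext_D_zero hΩ (L2_ext_of_forall_integral_smul_eq hΩ fun φ hφ => ?_)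
    have := neg_injective ((h φ hφ).symm.trans (h' φ hφ))
    simpa only [pairing_apply, derivL_apply] using this
  choose A hA using hex
  let A' : Sobolev Ω (2 + p) →ₗ[ℝ] Sobolev Ω p :=
    { toFun := A
      map_add' := fun u v => huniq _ _ _ (hA _) fun φ hφ => by
        simp only [map_add, Finset.sum_add_distrib, neg_add, hA u φ hφ, hA v φ hφ]
      map_smul' := fun c u => huniq _ _ _ (hA _) fun φ hφ => by
        simp only [map_smul, RingHom.id_apply, ← Finset.smul_sum, hA u φ hφ, smul_neg] }
  have hiff : ∀ u w, G u w ↔ w = A u := fun u w =>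
    ⟨fun h => huniq u _ _ h (hA u), fun h => h ▸ hA u⟩
  -- The graph is cut out by weak identities continuous in `(u, w)`, so the closed graph theorem
  -- applies.
  have hclosed : IsClosed (A'.graph : Set (Sobolev Ω (2 + p) × Sobolev Ω p)) := by
    have : (A'.graph : Set (Sobolev Ω (2 + p) × Sobolev Ω p)) = {z | G z.1 z.2} := by
      ext z
      exact (hiff z.1 z.2).symm
    rw [this]
    simp only [hG, Set.ofPred_forall]
    exact isClosed_iInter fun φ => isClosed_iInter fun hφ =>
      isClosed_eq (by fun_prop) (by fun_prop)
  exact ⟨ContinuousLinearMap.ofIsClosedGraph hclosed, hiff⟩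

theorem isClosed_convex_admissibleSolutions {T : ℝ} (hT : 0 < T) (hΩ : IsOpen Ω)
    (hb : Bornology.IsBounded Ω) (p : ℕ) {C : Space d → Fin d → Fin d → Fin d → Fin d → ℝ}
    (hC : ∀ i j k l, ContDiffOn ℝ (p + 1 : ℕ) (fun x => C x i j k l) (closure Ω))
    (f g : ℝ → Space d → Space d) :
    IsClosed (admissibleSolutions T Ω p C f g) ∧ Convex ℝ (admissibleSolutions T Ω p C f g) := by
  have : IsFiniteMeasure (volume.restrict Ω) := ⟨by simpa using hb.measure_lt_top⟩
  obtain ⟨A, hA⟩ := exists_elasticityOperator hΩ p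
    fun i j k l => hasBddDerivs_of_contDiffOn_closure hΩ hb (hC i j k l)
  -- At almost every time the weak divergence equation says `w t = A (u t)`, which splits the
  -- solution set into an abstract evolution equation and two conditions pointwise in time.
  have hset : admissibleSolutions T Ω p C f g =
      {u : L2Sobolev T Ω (2 + p) | ∃ v w : L2Sobolev T Ω p,
        HasWeakTimeDeriv T (fun t => inclL Ω p (u t)) v ∧ HasWeakTimeDeriv T v w ∧
          ∀ᵐ t ∂timeMeasure T, w t = A (u t)} ∩
      ({u | ∀ᵐ t ∂timeMeasure T, u t ∈ {U | HasTrace U (f t)}} ∩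
        {u | ∀ᵐ t ∂timeMeasure T, u t ∈ {U | HasNormalTrace U (g t)}}) := by
    ext u
    constructor
    · rintro ⟨v, w, h1, h2, h3, h4, h5⟩
      exact ⟨⟨v, w, h1, h2, h3.mono fun t ht => (hA _ _).1 ht⟩, h4, h5⟩
    · rintro ⟨⟨v, w, h1, h2, h3⟩, h4, h5⟩
      exact ⟨v, w, h1, h2, h3.mono fun t ht => (hA _ _).2 ht, h4, h5⟩
  have ht := isClosed_convex_setOf_weakTimeDeriv hT A (inclL Ω p)
  rw [hset]
  exact ⟨ht.1.inter ((isClosed_setOf_ae_mem fun t =>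
      (isClosed_convex_setOf_hasTrace _ (f t)).1).inter
      (isClosed_setOf_ae_mem fun t => (isClosed_convex_setOf_hasNormalTrace _ (g t)).1)),
    ht.2.inter ((convex_setOf_ae_mem fun t => (isClosed_convex_setOf_hasTrace _ (f t)).2).inter
      (convex_setOf_ae_mem fun t => (isClosed_convex_setOf_hasNormalTrace _ (g t)).2))⟩

end Elasticity

end ElasticWave

end

theorem mainTheorem2 (d : ℕ) (hd : 2 ≤ d) (T : ℝ) (hT : 0 < T)
    (Ω : Set (ElasticWave.Space d)) (hΩ : ElasticWave.IsSmoothBoundedDomain Ω) (p : ℕ)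
    (C : ElasticWave.Space d → Fin d → Fin d → Fin d → Fin d → ℝ)
    (hC : ElasticWave.IsElasticityTensor Ω (max 2 (p + 1)) C)
    (f g : ℝ → ElasticWave.Space d → ElasticWave.Space d)
    (hS : (ElasticWave.admissibleSolutions T Ω p C f g).Nonempty) :
    ∃! u : ElasticWave.L2Sobolev T Ω (2 + p),
      u ∈ ElasticWave.admissibleSolutions T Ω p C f g ∧
      ∀ v ∈ ElasticWave.admissibleSolutions T Ω p C f g,
        ElasticWave.weightedNorm u ≤ ElasticWave.weightedNorm v := by
  have h := ElasticWave.isClosed_convex_admissibleSolutions hT hΩ.isOpen hΩ.isBounded p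
    (fun i j k l => (hC.contDiffOn i j k l).of_le (by exact_mod_cast le_max_right 2 (p + 1))) f g
  exact ElasticWave.existsUnique_weightedNorm_le hS h.1 h.2
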